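/- Let $C$ be a set of $m\ge 2$ candidates and $V$ a finite set of voters, each voter $v$ having a linear order $\succ_v$ over $C$ as vote. A scoring vector is $\alpha=(\alpha_1,\dots,\alpha_m)\in\mathbb{R}^m$ with $\alpha_1\ge\dots\ge\alpha_m$ and $\alpha_1>\alpha_m$. A candidate gets $\alpha_i$ points from each vote that ranks it in position $i$; the scoring rule $r$ of $\alpha$ selects, among the candidates with maximum total score, the one that comes first in a fixed linear order $\succ_t$ over $C$. Let $P$ be a profile with current winner $x=r(P)$. For a candidate $y\ne x$, a set $M\subseteq V$ is a coalition of possible manipulators against $y$ if there are votes $(\succ'_j)_{j\in M}$, each ranking $x$ above $y$, such that $y$ wins under $r$ when the votes of the members of $M$ in $P$ are replaced by them (for $y=x$ no set is one). $M$ is a coalition of possible manipulators if it is one against some candidate $y$. CPMW is the problem to decide, given a scoring rule (a scoring vector with rational entries in binary and an order $\succ_t$), a profile, a set $M$ of voters and a candidate $y$, whether $M$ is a coalition of possible manipulators against $y$. CPM is the problem to decide, given the same data without $y$, whether $M$ is a coalition of possible manipulators. There is no bound on $m$, $|V|$ or $|M|$. **Theorem.** Consider scoring vectors with $\alpha_1-\alpha_2\le\alpha_i-\alpha_{i+1}$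 for all $1\le i<m$. (1) For every real scoring vector of this kind, every $\succ_t$, every profile with current winner $x$, every $M\subseteq V$ and every candidate $y\neq x$: $M$ is a coalition of possible manipulators against $y$ if and only if $y$ wins in the profile obtained by moving, in the vote of every member of $M$, $x$ to the first and $y$ to the second position while keeping the relative order of the other candidates. (2) Restricted to the scoring rules of this kind, CPMW and CPM are in $\mathsf{P}$. (3) For every $m\ge2$ the Borda vector $(m-1,m-2,\dots,1,0)$ is a scoring vector of this kind. -/

import Mathlib

/-! ### Elections and positional scoring rules -/

/-- A preference (linear order) over a set `C` of `m` candidates, given by the position of each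
candidate: position `0` is the most preferred one, position `m - 1` the least preferred one. -/
abbrev Preference (C : Type*) (m : ℕ) := C ≃ Fin m

/-- The voter with preference `p` strictly prefers `a` to `b`. -/
def Preference.Prefers {C : Type*} {m : ℕ} (p : Preference C m) (a b : C) : Prop := p a < p b

/-- Move the candidate `c` to the top of the preference `p`; the relative order of all other
candidates is unchanged. -/
def Preference.moveToTop {C : Type*} {m : ℕ} (p : Preference C m) (c : C) : Preference C m :=
  p.trans (Fin.cycleRange (p c))

/-- A preference profile of the voters `V`. -/
abbrev Profile (V C : Type*) (m : ℕ) := V → Preference C m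

/-- A (resolute) voting rule for the voters `V` and the candidates `C`. -/
abbrev VotingRule (V C : Type*) (m : ℕ) := Profile V C m → C

/-- `α₁ ≥ α₂ ≥ ⋯ ≥ α_m` and `α₁ > α_m` (positions are counted from `0` here). -/
structure IsScoringVector {m : ℕ} (α : Fin m → ℝ) : Prop where
  two_le : 2 ≤ m
  antitone : Antitone α
  last_lt_first : α ⟨m - 1, by omega⟩ < α ⟨0, by omega⟩

/-- `α₁ - α₂ ≤ αᵢ - αᵢ₊₁` for all `i` (positions are counted from `0` here). -/
def FirstGapMinimal {m : ℕ} (α : Fin m → ℝ) : Prop :=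
  ∀ (i : ℕ) (hi : i + 1 < m),
    α ⟨0, by omega⟩ - α ⟨1, by omega⟩ ≤ α ⟨i, by omega⟩ - α ⟨i + 1, hi⟩

/-- The Borda vector `(m - 1, m - 2, …, 1, 0)`. -/
def bordaVector (m : ℕ) : Fin m → ℝ := fun i => (m : ℝ) - 1 - (i : ℕ)

/-- The total score of a candidate. -/
def totalScore {V C : Type*} [Fintype V] {m : ℕ} (α : Fin m → ℝ) (P : Profile V C m) (c : C) : ℝ :=
  ∑ v, α (P v c)

open Classical in
/-- The voting correspondence of a scoring rule: the candidates with maximum score. -/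
noncomputable def topScorers {V C : Type*} [Fintype V] [Fintype C] {m : ℕ} (α : Fin m → ℝ)
    (P : Profile V C m) : Finset C :=
  Finset.univ.filter fun c => ∀ d, totalScore α P d ≤ totalScore α P c

theorem topScorers_nonempty {V C : Type*} [Fintype V] [Fintype C] [Nonempty C] {m : ℕ}
    (α : Fin m → ℝ) (P : Profile V C m) : (topScorers α P).Nonempty := by
  obtain ⟨c, hc⟩ := Finite.exists_max (totalScore α P)
  exact ⟨c, by simpa [topScorers] using hc⟩

/-- Lexicographic tie breaking: the member of `S` that is most preferred in the order `t`. -/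
def lexTieBreak {C : Type*} {m : ℕ} (t : Preference C m) (S : Finset C) (hS : S.Nonempty) : C :=
  t.symm ((S.map t.toEmbedding).min' (by simpa using hS))

/-- The scoring rule of the vector `α` with lexicographic tie breaking according to `t`. -/
noncomputable def scoringRule {V C : Type*} [Fintype V] [Fintype C] [Nonempty C] {m : ℕ}
    (α : Fin m → ℝ) (t : Preference C m) : VotingRule V C m :=
  fun P => lexTieBreak t (topScorers α P) (topScorers_nonempty α P)

/-! ### Coalitions of possible manipulators -/

open Classical in
/-- The profile `P` with the votes of the voters in `M` replaced by those of `Q`. -/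
noncomputable def replaceVotes {V C : Type*} {m : ℕ} (P : Profile V C m) (M : Finset V)
    (Q : Profile {v // v ∈ M} C m) : Profile V C m :=
  fun v => if h : v ∈ M then Q ⟨v, h⟩ else P v

/-- `M` is a coalition of possible manipulators against `y`: the candidate `y` is not the current
winner `r P`, and the voters in `M` have preferences that all prefer the current winner to `y` and
with which `y` would have won. -/
def IsCoalitionAgainst {V C : Type*} {m : ℕ} (r : VotingRule V C m) (P : Profile V C m)
    (M : Finset V) (y : C) : Prop :=
  y ≠ r P ∧ ∃ Q : Profile {v // v ∈ M} C m,
    (∀ j, (Q j).Prefers (r P) y) ∧ r (replaceVotes P M Q) = y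

/-- `M` is a coalition of possible manipulators: it is one against some candidate. -/
def IsCoalition {V C : Type*} {m : ℕ} (r : VotingRule V C m) (P : Profile V C m)
    (M : Finset V) : Prop :=
  ∃ y, IsCoalitionAgainst r P M y

/-- The coalition's votes in the test: in the reported vote of each member, `x` is moved to the
first and `y` to the second position, the order of the other candidates being kept. -/
def testVotes {V C : Type*} {m : ℕ} (P : Profile V C m) (M : Finset V) (x y : C) :
    Profile {v // v ∈ M} C m :=
  fun j => ((P j).moveToTop y).moveToTop x

/-! ### Polynomial time -/

open Classical in
/-- The decision problem `p` is in P, for inputs written as strings by `enc`: a Turing machine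
decides it within a number of steps that is polynomial in the length of the input. -/
def InP {A Γ : Type} (enc : A → List Γ) (p : A → Prop) : Prop :=
  Nonempty (Turing.TM2ComputableInPolyTime enc Computability.encodeBool fun a => decide (p a))

/-! ### The two decision problems -/

/-- An input of the problem CPM: a scoring rule (a scoring vector with rational entries and a
tie-breaking order), a profile of `n` voters over `m` candidates, and a set `M` of voters. -/
structure CPMInput where
  m : ℕ
  n : ℕ
  scores : Fin m → ℚ
  tie : Preference (Fin m) m
  profile : Profile (Fin n) (Fin m) m
  M : Finset (Fin n)
  isScoringVector : IsScoringVector fun i => (scores i : ℝ)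

/-- An input of the problem CPMW: in addition, a candidate `y`. -/
structure CPMWInput extends CPMInput where
  y : Fin m

namespace CPMInput

/-- The scoring vector of an input. -/
def vector (I : CPMInput) : Fin I.m → ℝ := fun i => (I.scores i : ℝ)

/-- The voting rule of an input. -/
noncomputable def rule (I : CPMInput) : VotingRule (Fin I.n) (Fin I.m) I.m :=
  haveI : Nonempty (Fin I.m) := ⟨⟨0, Nat.lt_of_lt_of_le Nat.two_pos I.isScoringVector.two_le⟩⟩
  scoringRule I.vector I.tie

end CPMInput

/-- The problem CPM. -/
def CPM (I : CPMInput) : Prop := IsCoalition I.rule I.profile I.M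

/-- The problem CPMW. -/
def CPMW (I : CPMWInput) : Prop := IsCoalitionAgainst I.rule I.profile I.M I.y

/-! ### Inputs as strings -/

namespace Encode

open Computability

/-- A natural number in binary, followed by a comma. -/
def nat (k : ℕ) : List Γ' := (encodeNat k).map Γ'.bit ++ [Γ'.comma]

/-- An integer: a sign bit (`true` if it is negative) and the absolute value in binary. -/
def int (z : ℤ) : List Γ' := Γ'.bit (decide (z < 0)) :: nat z.natAbs

/-- The least common denominator of a rational vector. -/
def commonDen {m : ℕ} (q : Fin m → ℚ) : ℕ := Finset.univ.lcm fun i => (q i).den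

/-- A rational vector, brought to its least common denominator: the denominator, then the
(integral) numerators. The length is polynomially related to that of the entries written one by
one as reduced fractions. -/
def ratVector {m : ℕ} (q : Fin m → ℚ) : List Γ' :=
  nat (commonDen q) ++ (List.finRange m).flatMap (fun i => int (q i * commonDen q).num) ++ [Γ'.ket]

/-- A preference: the candidates from the most to the least preferred one. -/
def preference {m : ℕ} (p : Preference (Fin m) m) : List Γ' :=
  (List.finRange m).flatMap (fun i => nat (p.symm i : ℕ)) ++ [Γ'.ket]

/-- An input of CPM: the scoring vector, the tie-breaking order, and for each voter a bit that
tells whether the voter belongs to `M`, with the vote. -/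
def cpm (I : CPMInput) : List Γ' :=
  ratVector I.scores ++ preference I.tie ++
    (List.finRange I.n).flatMap fun v => Γ'.bit (decide (v ∈ I.M)) :: preference (I.profile v)

/-- An input of CPMW: the candidate `y`, then the rest as for CPM. -/
def cpmw (I : CPMWInput) : List Γ' := nat (I.y : ℕ) ++ cpm I.toCPMInput

end Encode

/-!
Moving `x` to the first and `y` to the second position gives the candidates other than `x` and `y`
no more points than before, while `x` gets no fewer. A member of the coalition has to prefer `x` to
`y`, so in an admissible vote the lead of `x` over `y` is at least `α₁ - α₂`, as the first gap is
minimal, and the test votes attain this lead. Hence a `y` that wins with some admissible votes is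
ahead of `x` in the test, while `x`, the winner of the truthful profile, stays ahead of all others.

For the decision problems, the test is run by a Turing machine with stacks. Data are trees, stored
as prefix codes that structured stack programs can cut, copy and compare. The functions computed by
such programs in polynomial time are closed under composition, pairing, case distinction and folds
along lists whose state grows by a bounded amount in each step; the arithmetic, the search for the
winner and the test are built from these operations.
-/

/-! ### The test -/

section Election

variable {V C : Type*} {m : ℕ}

theorem lexTieBreak_eq_iff (t : Preference C m) (S : Finset C) (hS : S.Nonempty) (c : C) :
    lexTieBreak t S hS = c ↔ c ∈ S ∧ ∀ d ∈ S, t c ≤ t d := by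
  rw [lexTieBreak, Equiv.symm_apply_eq, Finset.min'_eq_iff]
  simp only [Finset.mem_map_equiv, Equiv.symm_apply_apply, ← t.forall_congr_right]

/-- The total score of a candidate, together with its place in the tie-breaking order: a scoring
rule selects the candidate with the greatest standing. -/
noncomputable def standing [Fintype V] (α : Fin m → ℝ) (t : Preference C m) (P : Profile V C m)
    (c : C) : ℝ ×ₗ (Fin m)ᵒᵈ :=
  toLex (totalScore α P c, OrderDual.toDual (t c))

theorem standing_le_iff [Fintype V] {α : Fin m → ℝ} {t : Preference C m}
    {P : Profile V C m} {c d : C} :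
    standing α t P c ≤ standing α t P d ↔ totalScore α P c < totalScore α P d ∨
      totalScore α P c = totalScore α P d ∧ t d ≤ t c :=
  Prod.Lex.toLex_le_toLex

theorem scoringRule_eq_iff [Fintype V] [Fintype C] [Nonempty C] {α : Fin m → ℝ}
    {t : Preference C m} {P : Profile V C m} {c : C} :
    scoringRule α t P = c ↔ ∀ d, standing α t P d ≤ standing α t P c := by
  simp only [scoringRule, lexTieBreak_eq_iff, topScorers, Finset.mem_filter_univ, standing_le_iff]
  constructor
  · rintro ⟨hmax, htie⟩ d
    rcases (hmax d).lt_or_eq with hlt | heq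
    · exact .inl hlt
    · exact .inr ⟨heq, htie d (heq ▸ hmax)⟩
  · refine fun h => ⟨fun d => ?_, fun d hd => ?_⟩
    · exact (h d).elim le_of_lt fun h => h.1.le
    · exact (h d).elim (fun hlt => absurd (hd c) hlt.not_ge) And.right

theorem standing_le_of_sub_le_sub {W : Type*} [Fintype V] [Fintype W] {α : Fin m → ℝ}
    {t : Preference C m} {P : Profile V C m} {Q : Profile W C m} {c d : C}
    (hle : standing α t P c ≤ standing α t P d)
    (hsub : totalScore α P d - totalScore α P c ≤ totalScore α Q d - totalScore α Q c) :
    standing α t Q c ≤ standing α t Q d := by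
  rw [standing_le_iff] at hle ⊢
  rcases hle with hlt | ⟨heq, htie⟩
  · exact .inl (by linarith)
  · exact (show totalScore α Q c ≤ totalScore α Q d by linarith).lt_or_eq.imp_right
      fun heq' => ⟨heq', htie⟩

namespace Preference

theorem coe_moveToTop_self (p : Preference C m) (c : C) : (p.moveToTop c c : ℕ) = 0 := by
  rw [moveToTop, Equiv.trans_apply, Fin.coe_cycleRange_of_le le_rfl, if_pos rfl]

theorem le_moveToTop (p : Preference C m) {c d : C} (hdc : d ≠ c) : p d ≤ p.moveToTop c d := by
  rw [moveToTop, Equiv.trans_apply]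
  rcases lt_or_gt_of_ne (p.injective.ne hdc) with hlt | hgt
  · rw [Fin.le_def, Fin.coe_cycleRange_of_lt hlt]
    exact Nat.le_succ _
  · rw [Fin.cycleRange_of_gt hgt]

theorem coe_moveToTop_moveToTop (p : Preference C m) {x y : C} (hyx : y ≠ x) :
    ((p.moveToTop y).moveToTop x y : ℕ) = 1 := by
  have hy := p.coe_moveToTop_self y
  have hlt : p.moveToTop y y < p.moveToTop y x :=
    lt_of_le_of_ne (Fin.le_def.mpr (hy ▸ Nat.zero_le _)) ((p.moveToTop y).injective.ne hyx)
  rw [moveToTop, Equiv.trans_apply, Fin.coe_cycleRange_of_lt hlt, hy]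

end Preference

theorem FirstGapMinimal.sub_le_sub {α : Fin m → ℝ} (hgap : FirstGapMinimal α) (hα : Antitone α)
    {a b i j : Fin m} (ha : (a : ℕ) = 0) (hb : (b : ℕ) = 1) (hij : i < j) :
    α a - α b ≤ α i - α j := by
  obtain ⟨a, _⟩ := a
  obtain ⟨b, _⟩ := b
  obtain rfl : a = 0 := ha
  obtain rfl : b = 1 := hb
  have hgap_i := hgap i (by omega)
  have hj : α j ≤ α ⟨i + 1, by omega⟩ := hα (Fin.le_def.mpr (Nat.succ_le_of_lt hij))
  linarith

theorem replaceVotes_of_mem {P : Profile V C m} {M : Finset V} {Q : Profile {v // v ∈ M} C m}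
    {v : V} (hv : v ∈ M) : replaceVotes P M Q v = Q ⟨v, hv⟩ := dif_pos hv

theorem replaceVotes_of_notMem {P : Profile V C m} {M : Finset V}
    {Q : Profile {v // v ∈ M} C m} {v : V} (hv : v ∉ M) : replaceVotes P M Q v = P v := dif_neg hv

theorem testVotes_prefers (P : Profile V C m) (M : Finset V) {x y : C} (hyx : y ≠ x)
    (j : {v // v ∈ M}) : (testVotes P M x y j).Prefers x y := by
  rw [Preference.Prefers, Fin.lt_def, testVotes, Preference.coe_moveToTop_self,
    Preference.coe_moveToTop_moveToTop _ hyx]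
  exact Nat.one_pos

section Scores

variable [Fintype V] {α : Fin m → ℝ} (P : Profile V C m) {M : Finset V} {x y : C}

theorem totalScore_le_totalScore_testVotes (hα : Antitone α) :
    totalScore α P x ≤ totalScore α (replaceVotes P M (testVotes P M x y)) x := by
  refine Finset.sum_le_sum fun v _ => hα ?_
  by_cases hv : v ∈ M
  · rw [replaceVotes_of_mem hv, testVotes, Fin.le_def, Preference.coe_moveToTop_self]
    exact Nat.zero_le _
  · rw [replaceVotes_of_notMem hv]

theorem totalScore_testVotes_le_totalScore (hα : Antitone α) {c : C} (hcx : c ≠ x) (hcy : c ≠ y) :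
    totalScore α (replaceVotes P M (testVotes P M x y)) c ≤ totalScore α P c := by
  refine Finset.sum_le_sum fun v _ => hα ?_
  by_cases hv : v ∈ M
  · rw [replaceVotes_of_mem hv]
    exact ((P v).le_moveToTop hcy).trans (Preference.le_moveToTop _ hcx)
  · rw [replaceVotes_of_notMem hv]

theorem totalScore_sub_le_totalScore_testVotes_sub (hα : Antitone α) (hgap : FirstGapMinimal α)
    (hyx : y ≠ x) {Q : Profile {v // v ∈ M} C m} (hQ : ∀ j, (Q j).Prefers x y) :
    totalScore α (replaceVotes P M Q) y - totalScore α (replaceVotes P M Q) x ≤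
      totalScore α (replaceVotes P M (testVotes P M x y)) y -
        totalScore α (replaceVotes P M (testVotes P M x y)) x := by
  simp only [totalScore, ← Finset.sum_sub_distrib]
  refine Finset.sum_le_sum fun v _ => ?_
  by_cases hv : v ∈ M
  · simp only [replaceVotes_of_mem hv]
    have hxy := hgap.sub_le_sub hα (Preference.coe_moveToTop_self ((P v).moveToTop y) x)
      (Preference.coe_moveToTop_moveToTop (P v) hyx) (hQ ⟨v, hv⟩)
    rw [testVotes]
    linarith
  · simp only [replaceVotes_of_notMem hv, le_refl]

end Scores

theorem isCoalitionAgainst_iff [Fintype V] [Fintype C] [Nonempty C] {α : Fin m → ℝ}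
    {t : Preference C m} (hα : Antitone α) (hgap : FirstGapMinimal α) {P : Profile V C m}
    {M : Finset V} {x y : C} (hx : scoringRule α t P = x) (hyx : y ≠ x) :
    IsCoalitionAgainst (scoringRule α t) P M y ↔
      scoringRule α t (replaceVotes P M (testVotes P M x y)) = y := by
  rw [IsCoalitionAgainst, hx]
  refine ⟨fun ⟨_, Q, hQ, hy⟩ => ?_, fun hy => ⟨hyx, _, testVotes_prefers P M hyx, hy⟩⟩
  rw [scoringRule_eq_iff] at hx hy ⊢
  have hxy := standing_le_of_sub_le_sub (hy x)
    (totalScore_sub_le_totalScore_testVotes_sub P hα hgap hyx hQ)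
  intro c
  rcases eq_or_ne c y with rfl | hcy
  · exact le_rfl
  rcases eq_or_ne c x with rfl | hcx
  · exact hxy
  · exact (standing_le_of_sub_le_sub (hx c) (sub_le_sub (totalScore_le_totalScore_testVotes P hα)
      (totalScore_testVotes_le_totalScore P hα hcx hcy))).trans hxy

theorem isScoringVector_bordaVector (hm : 2 ≤ m) : IsScoringVector (bordaVector m) where
  two_le := hm
  antitone _ _ hij := sub_le_sub_left (Nat.cast_le.mpr hij) _
  last_lt_first := sub_lt_sub_left (Nat.cast_lt.mpr (show 0 < m - 1 by omega)) _

theorem firstGapMinimal_bordaVector (m : ℕ) : FirstGapMinimal (bordaVector m) := fun i _ => by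
  simp only [bordaVector]
  push_cast
  linarith

end Election

/-! ### A structured language for stack machines -/

namespace StackLang

open Turing TM2 StateTransition

/-- Structured programs for machines with stacks indexed by `K` and a register of type `σ`. The
loop `whilePop k f c p` pops from the stack `k`, combining the popped symbol with the register by
`f`, and if the register then satisfies `c`, it runs `p` and starts again. -/
inductive Prog {K : Type} (Γ : K → Type) (σ : Type)
  | skip
  | push (k : K) (f : σ → Γ k)
  | pop (k : K) (f : σ → Option (Γ k) → σ)
  | seq (p q : Prog Γ σ)
  | ite (c : σ → Bool) (p q : Prog Γ σ)
  | whilePop (k : K) (f : σ → Option (Γ k) → σ) (c : σ → Bool) (p : Prog Γ σ)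

namespace Prog

variable {K : Type} {Γ : K → Type} {σ : Type}

/-- The labels of the machine code of a program. -/
def Label : Prog Γ σ → Type
  | skip | push _ _ | pop _ _ => Unit
  | seq p q => p.Label ⊕ q.Label
  | ite _ p q => Option (p.Label ⊕ q.Label)
  | whilePop _ _ _ p => Option p.Label

/-- The label at which the execution of a program starts. -/
def entry : (p : Prog Γ σ) → p.Label
  | skip | push _ _ | pop _ _ => ()
  | seq p _ => .inl p.entry
  | ite _ _ _ | whilePop _ _ _ _ => none

theorem finite_label (p : Prog Γ σ) : Finite p.Label := by
  induction p with
  | skip | push | pop => exact inferInstanceAs (Finite Unit)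
  | seq p q _ _ => exact inferInstanceAs (Finite (p.Label ⊕ q.Label))
  | ite _ p q _ _ => exact inferInstanceAs (Finite (Option (p.Label ⊕ q.Label)))
  | whilePop _ _ _ p _ => exact inferInstanceAs (Finite (Option p.Label))

/-- The machine code of a program: `emb` places its labels among those of a machine, and `exit` is
the label to jump to at the end. -/
def code {L : Type} : (p : Prog Γ σ) → (emb : p.Label → L) → (exit : L) → p.Label → Stmt Γ L σ
  | skip, _, exit => fun _ => .goto fun _ => exit
  | push k f, _, exit => fun _ => .push k f (.goto fun _ => exit)
  | pop k f, _, exit => fun _ => .pop k f (.goto fun _ => exit)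
  | seq p q, emb, exit => fun
    | .inl l => p.code (emb ∘ .inl) (emb (.inr q.entry)) l
    | .inr l => q.code (emb ∘ .inr) exit l
  | ite c p q, emb, exit => fun
    | none => .branch c (.goto fun _ => emb (some (.inl p.entry)))
        (.goto fun _ => emb (some (.inr q.entry)))
    | some (.inl l) => p.code (emb ∘ some ∘ .inl) exit l
    | some (.inr l) => q.code (emb ∘ some ∘ .inr) exit l
  | whilePop k f c p, emb, exit => fun
    | none => .pop k f (.branch c (.goto fun _ => emb (some p.entry)) (.goto fun _ => exit))
    | some l => p.code (emb ∘ some) (emb none) l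

variable [DecidableEq K]

/-- `Exec p v S v' S' t`: started with register `v` and stacks `S`, the program `p` ends with
register `v'` and stacks `S'` within `t` steps. -/
inductive Exec : Prog Γ σ → σ → (∀ k, List (Γ k)) → σ → (∀ k, List (Γ k)) → ℕ → Prop
  | skip {v S} : Exec skip v S v S 1
  | push {k f v S} : Exec (push k f) v S v (Function.update S k (f v :: S k)) 1
  | pop {k f v S} : Exec (pop k f) v S (f v (S k).head?) (Function.update S k (S k).tail) 1
  | seq {p q v S v' S' v'' S'' t u} : Exec p v S v' S' t → Exec q v' S' v'' S'' u →
      Exec (seq p q) v S v'' S'' (t + u)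
  | ite_true {c p q v S v' S' t} : c v = true → Exec p v S v' S' t →
      Exec (ite c p q) v S v' S' (1 + t)
  | ite_false {c p q v S v' S' t} : c v = false → Exec q v S v' S' t →
      Exec (ite c p q) v S v' S' (1 + t)
  | whilePop_false {k f c p v S} : c (f v (S k).head?) = false →
      Exec (whilePop k f c p) v S (f v (S k).head?) (Function.update S k (S k).tail) 1
  | whilePop_true {k f c p v S v' S' v'' S'' t u} : c (f v (S k).head?) = true →
      Exec p (f v (S k).head?) (Function.update S k (S k).tail) v' S' t →
      Exec (whilePop k f c p) v' S' v'' S'' u → Exec (whilePop k f c p) v S v'' S'' (1 + (t + u))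
  | mono {p v S v' S' t u} : Exec p v S v' S' t → t ≤ u → Exec p v S v' S' u

theorem nonempty_evalsToInTime_trans {A : Type} {f : A → Option A} {a b : A} {c : Option A}
    {t u : ℕ} (hab : Nonempty (EvalsToInTime f a (some b) t))
    (hbc : Nonempty (EvalsToInTime f b c u)) : Nonempty (EvalsToInTime f a c (t + u)) :=
  let ⟨hab⟩ := hab
  let ⟨hbc⟩ := hbc
  ⟨add_comm u t ▸ hab.trans _ _ _ _ _ _ hbc⟩

theorem nonempty_evalsToInTime_one {A : Type} {f : A → Option A} {a : A} {b : Option A}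
    (hab : f a = b) : Nonempty (EvalsToInTime f a b 1) :=
  ⟨⟨⟨1, hab⟩, le_rfl⟩⟩

theorem Exec.evalsToInTime {L : Type} {M : L → Stmt Γ L σ} {p : Prog Γ σ} {v v' : σ}
    {S S' : ∀ k, List (Γ k)} {t : ℕ} (h : Exec p v S v' S' t) {emb : p.Label → L} {exit : L}
    (hM : ∀ l, M (emb l) = p.code emb exit l) :
    Nonempty (EvalsToInTime (TM2.step M) ⟨some (emb p.entry), v, S⟩ (some ⟨some exit, v', S'⟩)
      t) := by
  induction h generalizing exit with
  | skip | push | pop =>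
    refine nonempty_evalsToInTime_one ?_
    simp only [TM2.step, hM, code, TM2.stepAux]
  | seq _ _ ihp ihq =>
    exact nonempty_evalsToInTime_trans (ihp (emb := emb ∘ .inl) fun l => hM (.inl l))
      (ihq (emb := emb ∘ .inr) fun l => hM (.inr l))
  | ite_true hc _ ih =>
    refine nonempty_evalsToInTime_trans (nonempty_evalsToInTime_one ?_)
      (ih (emb := emb ∘ some ∘ .inl) fun l => hM (some (.inl l)))
    simp only [TM2.step, hM]
    simp only [entry, code, TM2.stepAux, hc, cond_true]
    rfl
  | ite_false hc _ ih =>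
    refine nonempty_evalsToInTime_trans (nonempty_evalsToInTime_one ?_)
      (ih (emb := emb ∘ some ∘ .inr) fun l => hM (some (.inr l)))
    simp only [TM2.step, hM]
    simp only [entry, code, TM2.stepAux, hc, cond_false]
    rfl
  | whilePop_false hc =>
    refine nonempty_evalsToInTime_one ?_
    simp only [TM2.step, hM]
    simp only [entry, code, TM2.stepAux, hc, cond_false]
  | whilePop_true hc _ _ ihp ih =>
    refine nonempty_evalsToInTime_trans (nonempty_evalsToInTime_one ?_)
      (nonempty_evalsToInTime_trans (ihp (emb := emb ∘ some) fun l => hM (some l)) (ih hM))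
    simp only [TM2.step, hM]
    simp only [entry, code, TM2.stepAux, hc, cond_true]
    rfl
  | mono _ htu ih =>
    obtain ⟨run⟩ := ih hM
    exact ⟨⟨run.toEvalsTo, run.steps_le_m.trans htu⟩⟩

end Prog

open Computability

/-- The stacks over the alphabet `Γ'`: `main` holds the codes of the trees a program works on, and
`depth` counts, in unary, the trees that remain to be moved. -/
inductive Stk
  | input
  | main
  | aux
  | spare
  | depth
  deriving DecidableEq

instance : Fintype Stk :=
  ⟨{.input, .main, .aux, .spare, .depth}, fun k => by cases k <;> decide⟩

/-- The alphabets of the stacks; `none` is the output stack. -/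
abbrev Sym : Option Stk → Type
  | some _ => Γ'
  | none => Bool

/-- Programs on trees. The register holds the symbol that was popped last. -/
abbrev TreeProg := Prog Sym (Option Γ')

/-- The contents of all stacks. -/
structure Store where
  output : List Bool := []
  input : List Γ' := []
  main : List Γ' := []
  aux : List Γ' := []
  spare : List Γ' := []
  depth : List Γ' := []

namespace Store

/-- The contents of a store as a family indexed by all stacks. -/
def contents (S : Store) : ∀ k, List (Sym k)
  | none => S.output
  | some .input => S.input
  | some .main => S.main
  | some .aux => S.aux
  | some .spare => S.spare
  | some .depth => S.depth

/-- The contents of the stack `k`. -/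
def get (S : Store) (k : Stk) : List Γ' := S.contents (some k)

/-- Replace the contents of the stack `k`. -/
def set (S : Store) (l : List Γ') : Stk → Store
  | .input => { S with input := l }
  | .main => { S with main := l }
  | .aux => { S with aux := l }
  | .spare => { S with spare := l }
  | .depth => { S with depth := l }

theorem update_contents_some (S : Store) (k : Stk) (l : List Γ') :
    Function.update S.contents (some k) l = (S.set l k).contents := by
  funext k'
  cases k <;> rcases k' with _ | _ | _ <;> rfl

theorem update_contents_none (S : Store) (l : List Bool) :
    Function.update S.contents none l = { S with output := l }.contents := by
  funext k'
  rcases k' with _ | _ | _ <;> rfl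

end Store

/-- Started with register `v`, the program `p` leads from `S` to `S'` within `t` steps. -/
def RunsFrom (v : Option Γ') (p : TreeProg) (S S' : Store) (t : ℕ) : Prop :=
  ∃ v', p.Exec v S.contents v' S'.contents t

/-- Whatever the register holds, the program `p` leads from `S` to `S'` within `t` steps. -/
def Runs (p : TreeProg) (S S' : Store) (t : ℕ) : Prop := ∀ v, RunsFrom v p S S' t

/-- Pop a symbol into the register. -/
def popReg (k : Stk) : TreeProg := .pop (some k) fun _ s => s

/-- Push the symbol in the register. -/
def pushReg (k : Stk) : TreeProg := .push (some k) fun v => v.getD .blank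

/-- Push the symbol `s`. -/
def pushSym (k : Stk) (s : Γ') : TreeProg := .push (some k) fun _ => s

/-- Whether the register holds an opening bracket, the first symbol of the code of an inner node. -/
def isBra (v : Option Γ') : Bool := v == some .bra

/-- Pop symbols from `k` and run `p` for each of them, as long as they satisfy `c`. -/
def loop (k : Stk) (c : Option Γ' → Bool) (p : TreeProg) : TreeProg :=
  .whilePop (some k) (fun _ s => s) c p

section

variable {v : Option Γ'} {p q : TreeProg} {S S' S'' : Store} {s : Γ'} {l : List Γ'} {k : Stk}
  {c : Option Γ' → Bool} {t u : ℕ}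

theorem RunsFrom.mono (h : RunsFrom v p S S' t) (htu : t ≤ u) : RunsFrom v p S S' u :=
  h.imp fun _ h => h.mono htu

theorem Runs.mono (h : Runs p S S' t) (htu : t ≤ u) : Runs p S S' u := fun v => (h v).mono htu

theorem RunsFrom.seq (h : RunsFrom v p S S' t) (h' : Runs q S' S'' u) :
    RunsFrom v (p.seq q) S S'' (t + u) :=
  let ⟨v', hp⟩ := h
  let ⟨v'', hq⟩ := h' v'
  ⟨v'', hp.seq hq⟩

theorem Runs.seq (h : Runs p S S' t) (h' : Runs q S' S'' u) : Runs (p.seq q) S S'' (t + u) :=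
  fun v => (h v).seq h'

theorem runs_skip : Runs .skip S S 1 := fun v => ⟨v, .skip⟩

theorem exec_popReg (hS : S.get k = s :: l) :
    (popReg k).Exec v S.contents (some s) (S.set l k).contents 1 := by
  have h := Prog.Exec.pop (k := some k) (f := fun _ s => s) (v := v) (S := S.contents)
  rw [Store.update_contents_some, show S.contents (some k) = s :: l from hS] at h
  exact h

theorem runs_popReg (hS : S.get k = s :: l) : Runs (popReg k) S (S.set l k) 1 :=
  fun _ => ⟨_, exec_popReg hS⟩

theorem runs_popReg_seq (hS : S.get k = s :: l) (h : RunsFrom (some s) q (S.set l k) S' t) :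
    Runs ((popReg k).seq q) S S' (1 + t) :=
  fun _ => h.imp fun _ h => (exec_popReg hS).seq h

theorem exec_pushReg :
    (pushReg k).Exec (some s) S.contents (some s) (S.set (s :: S.get k) k).contents 1 :=
  S.update_contents_some k _ ▸ .push

theorem runsFrom_pushReg : RunsFrom (some s) (pushReg k) S (S.set (s :: S.get k) k) 1 :=
  ⟨_, exec_pushReg⟩

theorem RunsFrom.pushReg_seq (h : RunsFrom (some s) q (S.set (s :: S.get k) k) S' t) :
    RunsFrom (some s) ((pushReg k).seq q) S S' (1 + t) :=
  h.imp fun _ h => exec_pushReg.seq h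

theorem runs_pushSym : Runs (pushSym k s) S (S.set (s :: S.get k) k) 1 :=
  fun v => ⟨v, S.update_contents_some k _ ▸ .push⟩

theorem RunsFrom.ite_true (hv : c v = true) (h : RunsFrom v p S S' t) :
    RunsFrom v (.ite c p q) S S' (1 + t) :=
  h.imp fun _ h => h.ite_true hv

theorem RunsFrom.ite_false (hv : c v = false) (h : RunsFrom v q S S' t) :
    RunsFrom v (.ite c p q) S S' (1 + t) :=
  h.imp fun _ h => h.ite_false hv

theorem runs_loop_nil (hS : S.get k = []) (hc : c none = false) :
    Runs (loop k c p) S (S.set [] k) 1 := by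
  intro v
  have h := Prog.Exec.whilePop_false (k := some k) (f := fun _ s => s) (c := c) (p := p) (v := v)
    (S := S.contents)
  rw [Store.update_contents_some, show S.contents (some k) = [] from hS] at h
  exact ⟨none, h hc⟩

theorem runs_loop_of_false (hS : S.get k = s :: l) (hc : c (some s) = false) :
    Runs (loop k c p) S (S.set l k) 1 := by
  intro v
  have h := Prog.Exec.whilePop_false (k := some k) (f := fun _ s => s) (c := c) (p := p) (v := v)
    (S := S.contents)
  rw [Store.update_contents_some, show S.contents (some k) = s :: l from hS] at h
  exact ⟨some s, h hc⟩

theorem runs_loop_of_true (hS : S.get k = s :: l) (hc : c (some s) = true)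
    (hp : RunsFrom (some s) p (S.set l k) S' t) (h : Runs (loop k c p) S' S'' u) :
    Runs (loop k c p) S S'' (1 + (t + u)) := by
  intro v
  obtain ⟨v', hp⟩ := hp
  obtain ⟨v'', h⟩ := h v'
  have step := Prog.Exec.whilePop_true (k := some k) (f := fun _ s => s) (c := c) (p := p) (v := v)
    (S := S.contents) (v' := v') (S' := S'.contents) (v'' := v'') (S'' := S''.contents) (t := t)
    (u := u)
  rw [Store.update_contents_some, show S.contents (some k) = s :: l from hS] at step
  exact ⟨v'', step hc hp h⟩

end

section

variable {o : List Bool} {i m a r d : List Γ'}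

/-- Pop all symbols from `k`, running `p` for each of them. -/
def forEach (k : Stk) (p : TreeProg) : TreeProg := loop k Option.isSome p

theorem forEach_runs {A : Type*} {k : Stk} {p : TreeProg} {c : ℕ} (F : A → List Γ' → Store)
    (step : A → Γ' → A) (hget : ∀ x l, (F x l).get k = l)
    (hset : ∀ x l l', (F x l).set l' k = F x l')
    (hp : ∀ x s l, RunsFrom (some s) p (F x l) (F (step x s) l) c) (x : A) (l : List Γ') :
    Runs (forEach k p) (F x l) (F (l.foldl step x) []) ((c + 1) * l.length + 1) := by
  induction l generalizing x with
  | nil =>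
    have run := runs_loop_nil (c := Option.isSome) (p := p) (hget x []) rfl
    rw [hset] at run
    exact run.mono (by omega)
  | cons s l ih =>
    refine (runs_loop_of_true (t := c) (hget x _) rfl ?_ (ih (step x s))).mono ?_
    · rw [hset]
      exact hp x s l
    · rw [List.length_cons]
      linarith

theorem forEach_aux_pushReg_spare_runs :
    Runs (forEach .aux (pushReg .spare)) ⟨o, i, m, a, r, d⟩ ⟨o, i, m, [], a.reverse ++ r, d⟩
      (2 * a.length + 1) := by
  simpa using forEach_runs (k := .aux) (p := pushReg .spare)
    (fun r a => ⟨o, i, m, a, r, d⟩) (fun l s => s :: l) (fun _ _ => rfl) (fun _ _ _ => rfl)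
    (fun _ _ _ => runsFrom_pushReg) r a

theorem forEach_spare_pushReg_aux_runs :
    Runs (forEach .spare (pushReg .aux)) ⟨o, i, m, a, r, d⟩ ⟨o, i, m, r.reverse ++ a, [], d⟩
      (2 * r.length + 1) := by
  simpa using forEach_runs (k := .spare) (p := pushReg .aux)
    (fun a r => ⟨o, i, m, a, r, d⟩) (fun l s => s :: l) (fun _ _ => rfl) (fun _ _ _ => rfl)
    (fun _ _ _ => runsFrom_pushReg) a r

theorem forEach_aux_pushReg_main_runs :
    Runs (forEach .aux (pushReg .main)) ⟨o, i, m, a, r, d⟩ ⟨o, i, a.reverse ++ m, [], r, d⟩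
      (2 * a.length + 1) := by
  simpa using forEach_runs (k := .aux) (p := pushReg .main)
    (fun m a => ⟨o, i, m, a, r, d⟩) (fun l s => s :: l) (fun _ _ => rfl) (fun _ _ _ => rfl)
    (fun _ _ _ => runsFrom_pushReg) m a

theorem forEach_aux_skip_runs :
    Runs (forEach .aux .skip) ⟨o, i, m, a, r, d⟩ ⟨o, i, m, [], r, d⟩ (2 * a.length + 1) :=
  forEach_runs (fun (_ : Unit) a => ⟨o, i, m, a, r, d⟩) (fun _ _ => ()) (fun _ _ => rfl)
    (fun _ _ _ => rfl) (fun _ _ _ => runs_skip _) () a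

/-! ### Trees on the main stack -/

/-- The prefix code of a binary tree. -/
def treeCode : BinaryTree Unit → List Γ'
  | .nil => [.ket]
  | .node _ x y => .bra :: (treeCode x ++ treeCode y)

/-- Move a symbol from `main` to `aux`, and count two more trees to be moved if it is the first one
of the code of an inner node. -/
def moveSymbol : TreeProg :=
  (popReg .main).seq ((pushReg .aux).seq
    (.ite isBra ((pushSym .depth .blank).seq (pushSym .depth .blank)) .skip))

theorem moveSymbol_ket :
    Runs moveSymbol ⟨o, i, .ket :: m, a, r, d⟩ ⟨o, i, m, .ket :: a, r, d⟩ 4 :=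
  runs_popReg_seq rfl (.pushReg_seq (.ite_false rfl (runs_skip _)))

theorem moveSymbol_bra :
    Runs moveSymbol ⟨o, i, .bra :: m, a, r, d⟩ ⟨o, i, m, .bra :: a, r, .blank :: .blank :: d⟩ 5 :=
  runs_popReg_seq rfl (.pushReg_seq (.ite_true rfl ((runs_pushSym.seq runs_pushSym) _)))

/-- Move trees from `main` to `aux`, one for each symbol on `depth`. -/
def moveTrees : TreeProg := forEach .depth moveSymbol

/-- Move the tree on top of `main` to `aux`, reversing its code. -/
def moveTree : TreeProg := (pushSym .depth .blank).seq moveTrees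

theorem moveTrees_runs (x : BinaryTree Unit) {m a d : List Γ'} {S : Store} {t : ℕ}
    (h : Runs moveTrees ⟨o, i, m, (treeCode x).reverse ++ a, r, d⟩ S t) :
    Runs moveTrees ⟨o, i, treeCode x ++ m, a, r, .blank :: d⟩ S
      (6 * (treeCode x).length + t) := by
  induction x generalizing m a d t with
  | nil =>
    refine (runs_loop_of_true rfl rfl (moveSymbol_ket _) h).mono ?_
    simp only [treeCode, List.length_singleton]
    omega
  | node _ x y ihx ihy =>
    simp only [treeCode, List.reverse_cons, List.reverse_append, List.append_assoc,
      List.singleton_append] at h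
    simp only [treeCode, List.cons_append, List.append_assoc]
    refine (runs_loop_of_true rfl rfl (moveSymbol_bra _) (ihx (ihy h))).mono ?_
    simp only [List.length_cons, List.length_append]
    omega

theorem moveTree_runs (x : BinaryTree Unit) :
    Runs moveTree ⟨o, i, treeCode x ++ m, a, r, []⟩ ⟨o, i, m, (treeCode x).reverse ++ a, r, []⟩
      (6 * (treeCode x).length + 2) :=
  (runs_pushSym.seq (moveTrees_runs x (runs_loop_nil rfl rfl))).mono (by omega)

/-- Remove the tree on top. -/
def dropTree : TreeProg := moveTree.seq (forEach .aux .skip)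

theorem dropTree_runs (x : BinaryTree Unit) :
    Runs dropTree { main := treeCode x ++ m } { main := m } (8 * (treeCode x).length + 3) :=
  ((moveTree_runs x).seq forEach_aux_skip_runs).mono (by
    simp only [List.append_nil, List.length_reverse]
    omega)

/-- Exchange the two trees on top. -/
def swapTrees : TreeProg :=
  moveTree.seq ((forEach .aux (pushReg .spare)).seq (moveTree.seq
    ((forEach .spare (pushReg .aux)).seq (forEach .aux (pushReg .main)))))

theorem swapTrees_runs (x y : BinaryTree Unit) :
    Runs swapTrees { main := treeCode x ++ (treeCode y ++ m) }
      { main := treeCode y ++ (treeCode x ++ m) }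
      (12 * ((treeCode x).length + (treeCode y).length) + 7) := by
  have run := (moveTree_runs (o := []) (i := []) (m := treeCode y ++ m) (a := []) (r := []) x).seq
    (forEach_aux_pushReg_spare_runs.seq ((moveTree_runs y).seq
      (forEach_spare_pushReg_aux_runs.seq forEach_aux_pushReg_main_runs)))
  simp only [List.append_nil, List.reverse_append, List.reverse_reverse, List.append_assoc,
    List.length_append, List.length_reverse] at run
  exact run.mono (by omega)

/-- Duplicate the tree on top. -/
def dupTree : TreeProg :=
  moveTree.seq ((forEach .aux ((pushReg .main).seq (pushReg .spare))).seq
    ((forEach .spare (pushReg .aux)).seq (forEach .aux (pushReg .main))))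

theorem dupTree_runs (x : BinaryTree Unit) :
    Runs dupTree { main := treeCode x ++ m } { main := treeCode x ++ (treeCode x ++ m) }
      (13 * (treeCode x).length + 5) := by
  have copy := forEach_runs (k := .aux) (p := (pushReg .main).seq (pushReg .spare))
    (fun r a => ⟨[], [], r ++ m, a, r, []⟩) (fun l s => s :: l) (fun _ _ => rfl) (fun _ _ _ => rfl)
    (fun _ _ _ => .pushReg_seq runsFrom_pushReg) [] (treeCode x).reverse
  simp only [List.foldl_flip_cons_eq_append', List.reverse_reverse, List.append_nil,
    List.nil_append] at copy
  have move := moveTree_runs (o := []) (i := []) (m := m) (a := []) (r := []) x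
  rw [List.append_nil] at move
  have run := move.seq
    (copy.seq
      (forEach_spare_pushReg_aux_runs.seq forEach_aux_pushReg_main_runs))
  simp only [List.append_nil, List.reverse_reverse, List.length_reverse] at run
  exact run.mono (by omega)

/-- Push a fixed list of symbols. -/
def pushList : List Γ' → TreeProg
  | [] => .skip
  | s :: l => (pushList l).seq (pushSym .main s)

theorem pushList_runs (l : List Γ') :
    Runs (pushList l) ⟨o, i, m, a, r, d⟩ ⟨o, i, l ++ m, a, r, d⟩ (l.length + 1) := by
  induction l with
  | nil => exact runs_skip
  | cons s l ih => exact (ih.seq runs_pushSym).mono (by rw [List.length_cons])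

variable {p q : TreeProg} {S S' : Store} {t u : ℕ}

/-- Pop the top symbol; run `p` if it is an opening bracket and `q` otherwise. -/
def caseTop (p q : TreeProg) : TreeProg := (popReg .main).seq (.ite isBra p q)

theorem caseTop_bra (h : Runs p { main := m } S t) :
    Runs (caseTop p q) { main := .bra :: m } S (t + 2) :=
  (runs_popReg_seq rfl (.ite_true rfl (h _))).mono (by omega)

theorem caseTop_ket (h : Runs q { main := m } S t) :
    Runs (caseTop p q) { main := .ket :: m } S (t + 2) :=
  (runs_popReg_seq rfl (.ite_false rfl (h _))).mono (by omega)

/-- Pop the top symbol and run `p`, as long as it is an opening bracket. -/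
def whileTop (p : TreeProg) : TreeProg := loop .main isBra p

theorem whileTop_ket : Runs (whileTop p) { main := .ket :: m } { main := m } 1 :=
  runs_loop_of_false rfl rfl

theorem whileTop_bra (h : Runs p { main := m } S t) (h' : Runs (whileTop p) S S' u) :
    Runs (whileTop p) { main := .bra :: m } S' (1 + (t + u)) :=
  runs_loop_of_true rfl rfl (h _) h'

end

end StackLang

/-! ### Functions computed in polynomial time -/

namespace StackLang

open Turing Computability Polynomial

/-- A representation of the elements of a type by trees. -/
class Enc (α : Type) where
  enc : α → BinaryTree Unit

-- The two trees have the same size, so that the size of a list of bits is a function of its length.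
instance : Enc Bool :=
  ⟨fun b => bif b then .node () (.node () .nil .nil) .nil else .node () .nil (.node () .nil .nil)⟩

instance {α β : Type} [Enc α] [Enc β] : Enc (α × β) :=
  ⟨fun x => .node () (Enc.enc x.1) (Enc.enc x.2)⟩

instance {α : Type} [Enc α] : Enc (List α) :=
  ⟨fun l => l.foldr (fun x t => .node () (Enc.enc x) t) .nil⟩

section

variable {α β : Type} [Enc α] [Enc β]

/-- The code of an element: the prefix code of the tree that represents it. -/
def encode (x : α) : List Γ' := treeCode (Enc.enc x)

/-- The length of the code of an element. -/
def size (x : α) : ℕ := (encode x).length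

theorem encode_pair (x : α) (y : β) : encode (x, y) = Γ'.bra :: (encode x ++ encode y) := rfl

theorem encode_cons (x : α) (l : List α) :
    encode (x :: l) = Γ'.bra :: (encode x ++ encode l) := rfl

@[simp] theorem size_pair (x : α) (y : β) : size (x, y) = size x + size y + 1 := by
  simp [size, encode_pair]

@[simp] theorem size_nil : size ([] : List α) = 1 := rfl

@[simp] theorem size_cons (x : α) (l : List α) : size (x :: l) = size x + size l + 1 := by
  simp [size, encode_cons]

@[simp] theorem size_bool (b : Bool) : size b = 5 := by cases b <;> rfl

theorem length_le_size (l : List α) : l.length ≤ size l := by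
  induction l with
  | nil => simp
  | cons x l ih => simp only [List.length_cons, size_cons]; omega

theorem size_le_size_of_mem {x : α} {l : List α} (hx : x ∈ l) : size x ≤ size l := by
  induction l with
  | nil => simp at hx
  | cons y l ih =>
    rw [size_cons]
    rcases List.mem_cons.1 hx with rfl | hx
    · omega
    · exact (ih hx).trans (by omega)

omit [Enc β] in
theorem size_foldl_le {g : α → β → α} {l : List β} {w : ℕ}
    (hg : ∀ e ∈ l, ∀ c, size (g c e) ≤ size c + w) (c : α) :
    size (l.foldl g c) ≤ size c + l.length * w := by
  induction l generalizing c with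
  | nil => simp
  | cons e l ih =>
    rw [List.forall_mem_cons] at hg
    have tail := ih hg.2 (g c e)
    have head := hg.1 c
    rw [List.foldl_cons, List.length_cons, Nat.succ_mul]
    omega

end

/-- Pop a truth value from the main stack and branch according to it. -/
def caseBool (p q : TreeProg) : TreeProg :=
  let skipRest := (popReg .main).seq ((popReg .main).seq (popReg .main))
  (popReg .main).seq (caseTop (skipRest.seq p) (skipRest.seq q))

theorem caseBool_runs {p q : TreeProg} {b : Bool} {m : List Γ'} {S : Store} {t : ℕ}
    (h : Runs (bif b then p else q) { main := m } S t) :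
    Runs (caseBool p q) { main := encode b ++ m } S (t + 6) := by
  have skipRest (s₁ s₂ s₃ : Γ') :
      Runs ((popReg .main).seq ((popReg .main).seq (popReg .main)))
        { main := s₁ :: s₂ :: s₃ :: m } { main := m } 3 :=
    (runs_popReg rfl).seq ((runs_popReg rfl).seq (runs_popReg rfl))
  cases b with
  | true => exact ((runs_popReg rfl).seq (caseTop_bra ((skipRest _ _ _).seq h))).mono (by omega)
  | false => exact ((runs_popReg rfl).seq (caseTop_ket ((skipRest _ _ _).seq h))).mono (by omega)

theorem eval_mono (q : ℕ[X]) : Monotone fun n => q.eval n := by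
  intro m n hmn
  induction q using Polynomial.induction_on' with
  | add p q hp hq => simpa only [eval_add] using add_le_add hp hq
  | monomial k a =>
    simpa only [eval_monomial] using Nat.mul_le_mul_left _ (Nat.pow_le_pow_left hmn k)

/-- The program `p` computes `f` on the top of the main stack, in a time and with a result of a
size bounded by `q`. -/
def Computes {α β : Type} [Enc α] [Enc β] (p : TreeProg) (q : ℕ[X]) (f : α → β) : Prop :=
  ∀ a, size (f a) ≤ q.eval (size a) ∧
    ∀ m, Runs p { main := encode a ++ m } { main := encode (f a) ++ m } (q.eval (size a))

/-- A function computed by a program in polynomial time. -/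
@[fun_prop]
def PolyTime {α β : Type} [Enc α] [Enc β] (f : α → β) : Prop :=
  ∃ p q, Computes p q f

namespace PolyTime

variable {α β γ : Type} [Enc α] [Enc β] [Enc γ]

theorem of_encode_eq {f : α → β} (h : ∀ a, encode (f a) = encode a) : PolyTime f := by
  refine ⟨.skip, X + 1, fun a => ⟨?_, fun m => ?_⟩⟩
  · simp [size, h]
  · rw [h]
    exact runs_skip.mono (by simp)

@[fun_prop]
theorem id' : PolyTime (fun a : α => a) := of_encode_eq fun _ => rfl

@[fun_prop]
theorem const (b : β) : PolyTime (fun _ : α => b) := by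
  refine ⟨dropTree.seq (pushList (encode b)), 8 * X + 4 + C (size b), fun a => ⟨?_, fun m => ?_⟩⟩
  · simp
  · refine ((dropTree_runs (Enc.enc a)).seq (pushList_runs (encode b))).mono ?_
    simp only [size, encode, eval_add, eval_mul, eval_X, eval_ofNat, eval_C]
    omega

@[fun_prop]
theorem comp {g : β → γ} {f : α → β} (hg : PolyTime g) (hf : PolyTime f) :
    PolyTime (fun a => g (f a)) := by
  obtain ⟨pg, qg, hg⟩ := hg
  obtain ⟨pf, qf, hf⟩ := hf
  refine ⟨pf.seq pg, qf + qg.comp qf, fun a => ?_⟩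
  have mono := eval_mono qg (hf a).1
  simp only [eval_add, eval_comp]
  exact ⟨((hg (f a)).1.trans mono).trans (Nat.le_add_left _ _),
    fun m => (((hf a).2 m).seq ((hg (f a)).2 m)).mono (Nat.add_le_add_left mono _)⟩

@[fun_prop]
theorem prodMk {f : α → β} {g : α → γ} (hf : PolyTime f) (hg : PolyTime g) :
    PolyTime (fun a => (f a, g a)) := by
  obtain ⟨pf, qf, hf⟩ := hf
  obtain ⟨pg, qg, hg⟩ := hg
  refine ⟨dupTree.seq (pf.seq (swapTrees.seq (pg.seq (swapTrees.seq (pushSym .main .bra))))),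
    25 * qf + 13 * qg + 25 * X + 20, fun a => ?_⟩
  have hf_size := (hf a).1
  have hg_size := (hg a).1
  simp only [eval_add, eval_mul, eval_X, eval_ofNat, size_pair]
  refine ⟨by omega, fun m => ?_⟩
  rw [encode_pair, List.cons_append, List.append_assoc]
  refine ((dupTree_runs (Enc.enc a)).seq (((hf a).2 (encode a ++ m)).seq
    ((swapTrees_runs (Enc.enc (f a)) (Enc.enc a)).seq (((hg a).2 (encode (f a) ++ m)).seq
      ((swapTrees_runs (Enc.enc (g a)) (Enc.enc (f a))).seq runs_pushSym))))).mono ?_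
  simp only [size, encode] at *
  omega

@[fun_prop]
theorem fst {f : α → β × γ} (hf : PolyTime f) : PolyTime (fun x => (f x).1) := by
  suffices h : PolyTime (fun y : β × γ => y.1) from h.comp hf
  refine ⟨(popReg .main).seq (swapTrees.seq dropTree), 20 * X + 11, fun ⟨b, c⟩ => ?_⟩
  simp only [eval_add, eval_mul, eval_X, eval_ofNat, size_pair]
  refine ⟨by omega, fun m => ?_⟩
  rw [encode_pair, List.cons_append, List.append_assoc]
  refine ((runs_popReg rfl).seq
    ((swapTrees_runs (Enc.enc b) (Enc.enc c)).seq (dropTree_runs (Enc.enc c)))).mono ?_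
  simp only [size, encode]
  omega

@[fun_prop]
theorem snd {f : α → β × γ} (hf : PolyTime f) : PolyTime (fun x => (f x).2) := by
  suffices h : PolyTime (fun y : β × γ => y.2) from h.comp hf
  refine ⟨(popReg .main).seq dropTree, 8 * X + 4, fun ⟨b, c⟩ => ?_⟩
  simp only [eval_add, eval_mul, eval_X, eval_ofNat, size_pair]
  refine ⟨by omega, fun m => ?_⟩
  rw [encode_pair, List.cons_append, List.append_assoc]
  refine ((runs_popReg rfl).seq (dropTree_runs (Enc.enc b))).mono ?_
  simp only [size, encode]
  omega

@[fun_prop]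
theorem cons {f : α → β} {g : α → List β} (hf : PolyTime f) (hg : PolyTime g) :
    PolyTime (fun a => f a :: g a) :=
  (of_encode_eq (f := fun x : β × List β => x.1 :: x.2) fun _ => rfl).comp (hf.prodMk hg)

@[fun_prop]
theorem cond {c : α → Bool} {f g : α → β} (hc : PolyTime c) (hf : PolyTime f)
    (hg : PolyTime g) : PolyTime (fun a => bif c a then f a else g a) := by
  obtain ⟨pc, qc, hc⟩ := hc
  obtain ⟨pf, qf, hf⟩ := hf
  obtain ⟨pg, qg, hg⟩ := hg
  refine ⟨dupTree.seq (pc.seq (caseBool pf pg)), 13 * X + qc + qf + qg + 11, fun a => ?_⟩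
  have hf_size := (hf a).1
  have hg_size := (hg a).1
  simp only [eval_add, eval_mul, eval_X, eval_ofNat]
  refine ⟨by cases c a <;> simp only [cond_true, cond_false] <;> omega, fun m => ?_⟩
  have branch : Runs (bif c a then pf else pg) { main := encode a ++ m }
      { main := encode (bif c a then f a else g a) ++ m }
      (qf.eval (size a) + qg.eval (size a)) := by
    cases c a with
    | true => exact ((hf a).2 m).mono (by omega)
    | false => exact ((hg a).2 m).mono (by omega)
  refine ((dupTree_runs (Enc.enc a)).seq
    (((hc a).2 (encode a ++ m)).seq (caseBool_runs branch))).mono ?_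
  simp only [size, encode]
  omega

theorem listCases {l : α → List β} {f : α → γ} {g : α × β × List β → γ} (hl : PolyTime l)
    (hf : PolyTime f) (hg : PolyTime g) :
    PolyTime (fun a => List.casesOn (l a) (f a) fun x t => g (a, x, t) : α → γ) := by
  suffices h : PolyTime (fun y : List β × α =>
      (List.casesOn y.1 (f y.2) fun x t => g (y.2, x, t) : γ)) from h.comp (hl.prodMk id')
  obtain ⟨pf, qf, hf⟩ := hf
  obtain ⟨pg, qg, hg⟩ := hg
  refine ⟨(popReg .main).seq (caseTop ((pushSym .main .bra).seq (swapTrees.seq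
    ((pushSym .main .bra).seq pg))) pf), qf + qg + 12 * X + 12, fun ⟨l, a⟩ => ?_⟩
  simp only [eval_add, eval_mul, eval_X, eval_ofNat]
  cases l with
  | nil =>
    have mono := eval_mono qf (show size a ≤ size (([] : List β), a) by simp; omega)
    refine ⟨(hf a).1.trans (by dsimp only at mono; omega), fun m => ?_⟩
    exact ((runs_popReg rfl).seq (caseTop_ket ((hf a).2 m))).mono (by dsimp only at mono; omega)
  | cons x t =>
    have hg := hg (a, x, t)
    rw [show size (a, x, t) = size (x :: t, a) by simp; omega] at hg
    refine ⟨hg.1.trans (by omega), fun m => ?_⟩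
    have run := hg.2 m
    rw [encode_pair, List.cons_append, List.append_assoc] at run
    rw [encode_pair, List.cons_append, List.append_assoc]
    refine ((runs_popReg rfl).seq (caseTop_bra (runs_pushSym.seq
      ((swapTrees_runs (Enc.enc (x, t)) (Enc.enc a)).seq (runs_pushSym.seq run))))).mono ?_
    rw [show size (x :: t, a) = size (x, t) + size a + 1 by simp only [size_pair, size_cons]]
    simp only [size, encode]
    omega

/-- The body of the loop that computes a fold: `p` leads from an entry, the remaining entries and
the state to the remaining entries and the new state. -/
def foldStep (p : TreeProg) : TreeProg :=
  (pushSym .main .bra).seq ((pushSym .main .bra).seq (p.seq (popReg .main)))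

theorem foldStep_runs {g : α → γ → β → γ} {p : TreeProg} {q : ℕ[X]}
    (hp : Computes p q fun z : (β × List β) × α × γ => (z.1.2, z.2.1, g z.2.1 z.2.2 z.1.1))
    (x : β) (l : List β) (a : α) (c : γ) (m : List Γ') :
    Runs (foldStep p) { main := encode x ++ (encode l ++ (encode (a, c) ++ m)) }
      { main := encode l ++ (encode (a, g a c x) ++ m) }
      (q.eval (size (x :: l, a, c)) + 3) := by
  have run := (hp ((x, l), a, c)).2 m
  rw [encode_pair, encode_pair, List.cons_append, List.append_assoc, List.cons_append,
    List.append_assoc, encode_pair l, List.cons_append, List.append_assoc,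
    show size ((x, l), a, c) = size (x :: l, a, c) by simp] at run
  exact (runs_pushSym.seq (runs_pushSym.seq (run.seq (runs_popReg rfl)))).mono (by omega)

theorem whileTop_foldStep_runs {g : α → γ → β → γ} {p : TreeProg} {q : ℕ[X]}
    (hp : Computes p q fun z : (β × List β) × α × γ => (z.1.2, z.2.1, g z.2.1 z.2.2 z.1.1))
    {a : α} {l : List β} {w N : ℕ} (hg : ∀ e ∈ l, ∀ c, size (g a c e) ≤ size c + w) (c : γ)
    (hN : size (l, a, c) + l.length * w ≤ N) (m : List Γ') :
    Runs (whileTop (foldStep p)) { main := encode l ++ (encode (a, c) ++ m) }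
      { main := encode (a, l.foldl (g a) c) ++ m } (l.length * (q.eval N + 4) + 1) := by
  induction l generalizing c with
  | nil => exact whileTop_ket.mono (by omega)
  | cons x l ih =>
    rw [List.forall_mem_cons] at hg
    have grow := hg.1 c
    rw [List.length_cons, Nat.succ_mul] at hN
    have rest := ih hg.2 (g a c x) (by simp only [size_pair, size_cons] at hN ⊢; omega)
    have mono := eval_mono q (show size (x :: l, a, c) ≤ N by omega)
    dsimp only at mono
    rw [encode_cons, List.cons_append, List.append_assoc]
    refine (whileTop_bra (foldStep_runs hp x l a c m) rest).mono ?_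
    rw [List.length_cons, Nat.succ_mul]
    omega

/-- If a step of a fold could multiply the size of the accumulator, the size of the result could
be exponential; hence the bound on what a step adds. -/
theorem foldl {l : α → List β} {b : α → γ} {g : α → γ → β → γ} (hl : PolyTime l)
    (hb : PolyTime b) (hg : PolyTime fun y : α × β × γ => g y.1 y.2.2 y.2.1) (r : ℕ[X])
    (hr : ∀ a c e, size (g a c e) ≤ size c + r.eval (size a + size e)) :
    PolyTime (fun a => (l a).foldl (g a) (b a)) := by
  have hstep : PolyTime fun z : (β × List β) × α × γ => (z.1.2, z.2.1, g z.2.1 z.2.2 z.1.1) := by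
    refine prodMk (by fun_prop) (prodMk (by fun_prop) ?_)
    exact hg.comp (f := fun z : (β × List β) × α × γ => (z.2.1, z.1.1, z.2.2)) (by fun_prop)
  obtain ⟨p, q, hp⟩ := hstep
  suffices h : PolyTime fun y : List β × α × γ => (y.2.1, y.1.foldl (g y.2.1) y.2.2) from
    (h.comp (f := fun a => (l a, a, b a)) (by fun_prop)).snd
  refine ⟨(popReg .main).seq (whileTop (foldStep p)),
    X + X * r + X * (q.comp (X + X * r) + 4) + 2, fun ⟨l, a, c⟩ => ?_⟩
  simp only [eval_add, eval_mul, eval_comp, eval_X, eval_ofNat]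
  generalize hn : size (l, a, c) = n
  have length_le : l.length ≤ n := (length_le_size l).trans (by rw [← hn, size_pair]; omega)
  have grow (e) (he : e ∈ l) (c) : size (g a c e) ≤ size c + r.eval n := by
    refine (hr a c e).trans (Nat.add_le_add_left (eval_mono r ?_) _)
    have := size_le_size_of_mem he
    simp only [← hn, size_pair]
    omega
  have total_le : l.length * r.eval n ≤ n * r.eval n := Nat.mul_le_mul_right _ length_le
  constructor
  · have := size_foldl_le grow c
    simp only [size_pair] at hn ⊢
    omega
  · intro m
    have run := whileTop_foldStep_runs hp grow c (Nat.add_le_add hn.le total_le) m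
    rw [encode_pair, List.cons_append, List.append_assoc]
    refine ((runs_popReg rfl).seq run).mono ?_
    have := Nat.mul_le_mul_right (q.eval (n + n * r.eval n) + 4) length_le
    omega

end PolyTime

end StackLang

/-! ### Operations on lists -/

namespace StackLang

open Polynomial

section

variable {α : Type} [Enc α]

theorem size_append (l l' : List α) : size (l ++ l') + 1 = size l + size l' := by
  induction l with
  | nil => rw [List.nil_append, size_nil, Nat.add_comm]
  | cons x l ih => rw [List.cons_append, size_cons, size_cons]; omega

theorem size_reverse (l : List α) : size l.reverse = size l := by
  induction l with
  | nil => rfl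
  | cons x l ih =>
    have split := size_append l.reverse [x]
    rw [size_cons, size_nil] at split
    rw [List.reverse_cons, size_cons]
    omega

end

namespace PolyTime

variable {α β γ : Type} [Enc α] [Enc β] [Enc γ]

theorem exists_size_le {f : α → β} (hf : PolyTime f) :
    ∃ q : ℕ[X], ∀ a, size (f a) ≤ q.eval (size a) :=
  let ⟨_, q, hp⟩ := hf
  ⟨q, fun a => (hp a).1⟩

@[fun_prop]
theorem tail {l : α → List β} (hl : PolyTime l) : PolyTime fun a => (l a).tail := by
  convert! listCases (g := fun z => z.2.2) hl (const []) (by fun_prop) using 2 with a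
  cases l a <;> rfl

@[fun_prop]
theorem headD {l : α → List β} (hl : PolyTime l) (b : β) : PolyTime fun a => (l a).headD b := by
  convert! listCases (g := fun z => z.2.1) hl (const b) (by fun_prop) using 2 with a
  cases l a <;> rfl

@[fun_prop]
theorem isEmpty {l : α → List β} (hl : PolyTime l) : PolyTime fun a => (l a).isEmpty := by
  convert! listCases hl (const true) (const false) using 2 with a
  cases l a <;> rfl

@[fun_prop]
theorem not {f : α → Bool} (hf : PolyTime f) : PolyTime fun a => !f a := by
  convert! cond hf (const false) (const true) using 2

@[fun_prop]
theorem and {f g : α → Bool} (hf : PolyTime f) (hg : PolyTime g) :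
    PolyTime fun a => f a && g a := by
  convert! cond hf hg (const false) using 2 with a
  cases f a <;> rfl

@[fun_prop]
theorem or {f g : α → Bool} (hf : PolyTime f) (hg : PolyTime g) :
    PolyTime fun a => f a || g a := by
  convert! cond hf (const true) hg using 2

@[fun_prop]
theorem xor {f g : α → Bool} (hf : PolyTime f) (hg : PolyTime g) :
    PolyTime fun a => f a ^^ g a := by
  convert! cond hf hg.not hg using 2 with a
  cases f a
  · exact Bool.false_xor _
  · exact Bool.true_xor _

@[fun_prop]
theorem reverse {l : α → List β} (hl : PolyTime l) : PolyTime fun a => (l a).reverse := by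
  have reverse_fold := foldl (g := fun _ acc e => e :: acc) hl (const []) (by fun_prop) (X + 1)
    (by intro a c e; simp only [size_cons, eval_add, eval_X, eval_one]; omega)
  simpa using reverse_fold

theorem foldr {l : α → List β} {b : α → γ} {g : α → β → γ → γ} (hl : PolyTime l)
    (hb : PolyTime b) (hg : PolyTime fun y : α × β × γ => g y.1 y.2.1 y.2.2) (r : ℕ[X])
    (hr : ∀ a e c, size (g a e c) ≤ size c + r.eval (size a + size e)) :
    PolyTime (fun a => (l a).foldr (g a) (b a)) := by
  simpa using foldl (g := fun a c e => g a e c) hl.reverse hb hg r fun a c e => hr a e c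

@[fun_prop]
theorem append {l l' : α → List β} (hl : PolyTime l) (hl' : PolyTime l') :
    PolyTime fun a => l a ++ l' a := by
  have append_fold := foldr (g := fun _ e acc => e :: acc) hl hl' (by fun_prop) (X + 1)
    (by intro a e c; simp only [size_cons, eval_add, eval_X, eval_one]; omega)
  simpa using append_fold

theorem flatMap {l : α → List β} {f : α → β → List γ} (hl : PolyTime l)
    (hf : PolyTime fun y : α × β => f y.1 y.2) : PolyTime fun a => (l a).flatMap (f a) := by
  obtain ⟨q, hq⟩ := hf.exists_size_le
  have hstep : PolyTime fun y : α × β × List γ => f y.1 y.2.1 ++ y.2.2 :=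
    (hf.comp (f := fun y : α × β × List γ => (y.1, y.2.1)) (by fun_prop)).append (by fun_prop)
  convert! foldr (g := fun a e acc => f a e ++ acc) hl (const []) hstep (q.comp (X + 1)) ?_
    using 2 with a
  · rw [List.foldr_append_eq_append, List.append_nil, List.flatMap_def]
  · intro a e c
    have grow := hq (a, e)
    have split := size_append (f a e) c
    simp only [size_pair, eval_comp, eval_add, eval_X, eval_one] at grow ⊢
    omega

theorem map {l : α → List β} {f : α → β → γ} (hl : PolyTime l)
    (hf : PolyTime fun y : α × β => f y.1 y.2) : PolyTime fun a => (l a).map (f a) := by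
  simpa only [List.map_eq_flatMap] using flatMap (f := fun a x => [f a x]) hl (hf.cons (const []))

theorem filter {l : α → List β} {f : α → β → Bool} (hl : PolyTime l)
    (hf : PolyTime fun y : α × β => f y.1 y.2) : PolyTime fun a => (l a).filter (f a) := by
  convert! flatMap (f := fun a x => bif f a x then [x] else []) hl
    (cond hf (by fun_prop) (const [])) using 2 with a
  induction l a with
  | nil => rfl
  | cons x l ih => cases h : f a x <;> simp [h, ih]

theorem any {l : α → List β} {f : α → β → Bool} (hl : PolyTime l)
    (hf : PolyTime fun y : α × β => f y.1 y.2) : PolyTime fun a => (l a).any (f a) := by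
  convert! (filter hl hf).isEmpty.not using 2 with a
  rw [Bool.eq_iff_iff]
  simp

/-- The step of the fold that computes a `zip`, with the rest of the second list and the reversed
list of pairs as state. -/
def zipStep : List γ × List (β × γ) → β → List γ × List (β × γ)
  | ([], acc), _ => ([], acc)
  | (x :: t, acc), e => (t, (e, x) :: acc)

omit [Enc β] [Enc γ] in
theorem foldl_zipStep_snd (l : List β) (s : List γ × List (β × γ)) :
    (l.foldl zipStep s).2 = (l.zip s.1).reverse ++ s.2 := by
  induction l generalizing s with
  | nil => rfl
  | cons e l ih => obtain ⟨_ | ⟨x, t⟩, acc⟩ := s <;> simp [zipStep, ih]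

@[fun_prop]
theorem zip {l : α → List β} {l' : α → List γ} (hl : PolyTime l) (hl' : PolyTime l') :
    PolyTime fun a => (l a).zip (l' a) := by
  have hstep : PolyTime fun y : α × β × List γ × List (β × γ) => zipStep y.2.2 y.2.1 := by
    convert! listCases (l := fun y : α × β × List γ × List (β × γ) => y.2.2.1)
      (f := fun y => ([], y.2.2.2)) (g := fun z => (z.2.2, (z.1.2.1, z.2.1) :: z.1.2.2.2))
      (by fun_prop) (by fun_prop) (by fun_prop) using 2 with y
    obtain ⟨_, _, _ | _, _⟩ := y <;> rfl
  have hr (c : List γ × List (β × γ)) (e : β) : size (zipStep c e) ≤ size c + size e + 1 := by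
    obtain ⟨_ | ⟨x, t⟩, acc⟩ := c <;> simp [zipStep] <;> omega
  have zip_fold := (foldl (g := fun _ => zipStep) hl (hl'.prodMk (const [])) hstep (X + 1)
    fun a c e => (hr c e).trans
      (by simp only [eval_add, eval_X, eval_one]; omega)).snd.reverse
  simpa [foldl_zipStep_snd] using zip_fold

end PolyTime

end StackLang

/-! ### Input and output -/

namespace StackLang

open Turing Computability Polynomial

/-- The symbols of an input as pairs of bits: `(true, b)` for the bit `b`, `(false, true)` for a
comma, `(false, false)` for an end marker. -/
def symPair : Γ' → Bool × Bool
  | .bit b => (true, b)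
  | .comma => (false, true)
  | _ => (false, false)

theorem size_map_symPair (l : List Γ') : size (l.map symPair) = 12 * l.length + 1 := by
  induction l with
  | nil => rfl
  | cons s l ih =>
    rw [List.map_cons, size_cons, ih, size_pair, size_bool, size_bool, List.length_cons]
    omega

/-- Push `x` as first entry of the list on top of the main stack. -/
def pushEntry (x : Bool × Bool) : TreeProg := pushList (.bra :: encode x)

/-- Push the symbol in the register as first entry of the list on top of the main stack. -/
def consReg : TreeProg :=
  .ite (fun v => v == some (.bit true)) (pushEntry (true, true))
    (.ite (fun v => v == some (.bit false)) (pushEntry (true, false))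
      (.ite (fun v => v == some .comma) (pushEntry (false, true)) (pushEntry (false, false))))

theorem runsFrom_consReg (s : Γ') (i m : List Γ') :
    RunsFrom (some s) consReg { input := i, main := m }
      { input := i, main := .bra :: encode (symPair s) ++ m } 16 := by
  have push : RunsFrom (some s) (pushEntry (symPair s)) { input := i, main := m }
      { input := i, main := .bra :: encode (symPair s) ++ m } 13 := by
    refine (pushList_runs (.bra :: encode (symPair s))).mono ?_ _
    rw [List.length_cons, ← size, size_pair, size_bool, size_bool]
  rcases s with _ | (_ | _) | _ | _ | _
  case bit.true => exact (push.ite_true rfl).mono (by omega)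
  case bit.false => exact ((push.ite_true rfl).ite_false rfl).mono (by omega)
  case comma => exact ((push.ite_true rfl).ite_false rfl).ite_false rfl
  all_goals exact ((push.ite_false rfl).ite_false rfl).ite_false rfl

/-- Put the symbols of the input, in reverse order, as a list on the main stack. -/
def readInput : TreeProg := (pushSym .main .ket).seq (forEach .input consReg)

theorem readInput_runs (l : List Γ') :
    Runs readInput { input := l } { main := encode (l.map symPair).reverse }
      (17 * l.length + 2) := by
  have read := forEach_runs (k := .input)
    (fun (x : List (Bool × Bool)) l => { input := l, main := encode x })
    (fun x s => symPair s :: x) (fun _ _ => rfl) (fun _ _ _ => rfl)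
    (fun x s l => runsFrom_consReg s l (encode x)) [] l
  rw [List.foldl_flip_cons_eq_append, List.append_nil] at read
  exact (runs_pushSym.seq read).mono (by omega)

/-- Move the truth value on the main stack to the output stack, and clear the register. -/
def writeOutput : TreeProg :=
  (caseBool (.push none fun _ => true) (.push none fun _ => false)).seq (popReg .main)

theorem exec_writeOutput (b : Bool) (v : Option Γ') :
    writeOutput.Exec v { main := encode b : Store }.contents none
      { output := [b] : Store }.contents 8 := by
  have push : Runs (bif b then .push none fun _ => true else .push none fun _ => false)
      {} { output := [b] } 1 := fun v => by
    cases b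
    · exact ⟨v, Store.update_contents_none {} [false] ▸ .push⟩
    · exact ⟨v, Store.update_contents_none {} [true] ▸ .push⟩
  obtain ⟨v', write⟩ := caseBool_runs push v
  rw [List.append_nil] at write
  have clear := Prog.Exec.pop (k := some Stk.main) (f := fun (_ : Option Γ') s => s) (v := v')
    (S := { output := [b] : Store }.contents)
  rw [Store.update_contents_some] at clear
  exact write.seq clear

/-! ### The machine of a program -/

/-- The machine that runs a program and halts. -/
noncomputable def machine (p : TreeProg) : FinTM2 where
  K := Option Stk
  k₀ := some .input
  k₁ := none
  Γ := Sym
  Λ := Option p.Label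
  main := some p.entry
  ΛFin := haveI := p.finite_label; Fintype.ofFinite _
  σ := Option Γ'
  initialState := none
  Γk₀Fin := inferInstanceAs (Fintype Γ')
  m
    | none => .halt
    | some l => p.code some none l

theorem initList_machine (p : TreeProg) (l : List Γ') :
    initList (machine p) l = ⟨some (some p.entry), none, { input := l : Store }.contents⟩ := by
  unfold initList
  congr 1
  funext k
  rcases k with _ | _ | _ <;> rfl

theorem haltList_machine (p : TreeProg) (l : List Bool) :
    haltList (machine p) l = ⟨none, none, { output := l : Store }.contents⟩ := by
  unfold haltList
  congr 1
  funext k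
  rcases k with _ | _ | _ <;> rfl

theorem nonempty_outputsInTime_machine {p : TreeProg} {l : List Γ'} {l' : List Bool} {t : ℕ}
    (hp : p.Exec none { input := l : Store }.contents none { output := l' : Store }.contents t) :
    Nonempty (TM2OutputsInTime (machine p) l (some l') (t + 1)) := by
  change Nonempty (StateTransition.EvalsToInTime (machine p).step (initList (machine p) l)
    (some (haltList (machine p) l')) (t + 1))
  rw [initList_machine, haltList_machine]
  exact Prog.nonempty_evalsToInTime_trans
    (hp.evalsToInTime (M := (machine p).m) (emb := some) (exit := none) fun _ => rfl)
    (Prog.nonempty_evalsToInTime_one rfl)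

theorem inP_of_polyTime {A : Type} {enc : A → List Γ'} {P : A → Prop}
    {F : List (Bool × Bool) → Bool} (hF : PolyTime F)
    (h : ∀ a, F ((enc a).map symPair) = true ↔ P a) : InP enc P := by
  classical
  obtain ⟨p, q, hp⟩ : PolyTime fun l : List (Bool × Bool) => F l.reverse := hF.comp (by fun_prop)
  refine ⟨⟨⟨machine (readInput.seq (p.seq writeOutput)), Equiv.refl _, Equiv.refl _⟩,
    q.comp (12 * X + 1) + 17 * X + 11, fun a => Classical.choice ?_⟩⟩
  set l := (enc a).map symPair with hl
  have answer : F l = decide (P a) := by rw [Bool.eq_iff_iff, h a, decide_eq_true_iff]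
  obtain ⟨v, read⟩ := readInput_runs (enc a) none
  obtain ⟨v', run⟩ := (hp l.reverse).2 [] v
  dsimp only at run
  rw [List.append_nil, List.append_nil, List.reverse_reverse, answer] at run
  obtain ⟨outputs⟩ := nonempty_outputsInTime_machine (read.seq (run.seq (exec_writeOutput _ v')))
  have map_refl {B : Type} (l : List B) : l.map (Equiv.refl B).invFun = l := List.map_id l
  erw [map_refl, map_refl]
  refine ⟨⟨outputs.toEvalsTo, outputs.steps_le_m.trans ?_⟩⟩
  simp only [eval_add, eval_comp, eval_mul, eval_X, eval_ofNat, eval_one, size_reverse, hl,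
    size_map_symPair]
  omega

end StackLang

/-! ### Binary numbers -/

namespace StackLang

open Polynomial

/-- The value of a binary number, least significant bit first. -/
def bitsVal (l : List Bool) : ℕ := Nat.ofDigits 2 (l.map Bool.toNat)

@[simp] theorem bitsVal_nil : bitsVal [] = 0 := rfl

@[simp] theorem bitsVal_cons (b : Bool) (l : List Bool) :
    bitsVal (b :: l) = b.toNat + 2 * bitsVal l :=
  Nat.ofDigits_cons

theorem bitsVal_append (l l' : List Bool) :
    bitsVal (l ++ l') = bitsVal l + 2 ^ l.length * bitsVal l' := by
  rw [bitsVal, List.map_append, Nat.ofDigits_append, List.length_map, bitsVal, bitsVal]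

theorem size_bits (l : List Bool) : size l = 6 * l.length + 1 := by
  induction l with
  | nil => rfl
  | cons b l ih => rw [size_cons, size_bool, ih, List.length_cons]; omega

/-- The pairs of digits of two binary numbers, both filled up with leading zeros to the same
length. -/
def align (a b : List Bool) : List (Bool × Bool) :=
  (a ++ b.map fun _ => false).zip (b ++ a.map fun _ => false)

theorem length_align (a b : List Bool) : (align a b).length = a.length + b.length := by
  simp [align, Nat.add_comm]

theorem bitsVal_append_map_false (a b : List Bool) :
    bitsVal (a ++ b.map fun _ => false) = bitsVal a := by
  rw [bitsVal_append, Nat.add_eq_left]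
  induction b with
  | nil => exact Nat.mul_zero _
  | cons _ b ih => rw [List.map_cons, bitsVal_cons, Bool.toNat_false, Nat.zero_add,
      Nat.mul_left_comm, ih]

theorem bitsVal_map_fst_align (a b : List Bool) :
    bitsVal ((align a b).map Prod.fst) = bitsVal a := by
  rw [align, List.map_fst_zip (by simp [Nat.add_comm]), bitsVal_append_map_false]

theorem bitsVal_map_snd_align (a b : List Bool) :
    bitsVal ((align a b).map Prod.snd) = bitsVal b := by
  rw [align, List.map_snd_zip (by simp [Nat.add_comm]), bitsVal_append_map_false]

/-- A full adder; the state consists of the carry and the digits of the sum in reverse order. -/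
def addStep (s : Bool × List Bool) (d : Bool × Bool) : Bool × List Bool :=
  (d.1 && d.2 || s.1 && (d.1 ^^ d.2), (d.1 ^^ d.2 ^^ s.1) :: s.2)

/-- The sum of two binary numbers. -/
def addBits (a b : List Bool) : List Bool :=
  let s := (align a b).foldl addStep (false, [])
  (s.1 :: s.2).reverse

theorem addStep_toNat (a b c : Bool) :
    (a ^^ b ^^ c).toNat + 2 * (a && b || c && (a ^^ b)).toNat = a.toNat + b.toNat + c.toNat := by
  cases a <;> cases b <;> cases c <;> rfl

theorem bitsVal_foldl_addStep (l : List (Bool × Bool)) (c : Bool) (r : List Bool) :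
    bitsVal ((l.foldl addStep (c, r)).1 :: (l.foldl addStep (c, r)).2).reverse =
      bitsVal r.reverse +
        2 ^ r.length * (bitsVal (l.map Prod.fst) + bitsVal (l.map Prod.snd) + c.toNat) := by
  induction l generalizing c r with
  | nil => simp [bitsVal_append]
  | cons d l ih =>
    obtain ⟨a, b⟩ := d
    rw [List.foldl_cons, addStep, ih]
    simp only [List.map_cons, List.reverse_cons, bitsVal_append, bitsVal_cons, bitsVal_nil,
      List.length_reverse, List.length_cons]
    linear_combination 2 ^ r.length * addStep_toNat a b c

theorem bitsVal_addBits (a b : List Bool) : bitsVal (addBits a b) = bitsVal a + bitsVal b := by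
  simp [addBits, bitsVal_foldl_addStep, bitsVal_map_fst_align, bitsVal_map_snd_align,
    -List.reverse_cons]

theorem length_foldl_addStep_snd (l : List (Bool × Bool)) (s : Bool × List Bool) :
    (l.foldl addStep s).2.length = l.length + s.2.length := by
  induction l generalizing s with
  | nil => exact (Nat.zero_add _).symm
  | cons d l ih => rw [List.foldl_cons, ih, addStep, List.length_cons, List.length_cons]; omega

theorem length_addBits (a b : List Bool) : (addBits a b).length = a.length + b.length + 1 := by
  rw [addBits, List.length_reverse, List.length_cons, length_foldl_addStep_snd, length_align,
    List.length_nil, Nat.add_zero]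

/-- The comparison of two binary numbers, given the comparison of their last digits `s`. -/
def ltStep (s : Bool) (d : Bool × Bool) : Bool := bif d.1 ^^ d.2 then d.2 else s

/-- The test whether a binary number is less than another. -/
def ltBits (a b : List Bool) : Bool := (align a b).foldl ltStep false

theorem foldl_ltStep_iff (l : List (Bool × Bool)) (s : Bool) :
    l.foldl ltStep s = true ↔ bitsVal (l.map Prod.fst) < bitsVal (l.map Prod.snd) ∨
      bitsVal (l.map Prod.fst) = bitsVal (l.map Prod.snd) ∧ s = true := by
  induction l generalizing s with
  | nil => simp
  | cons d l ih =>
    obtain ⟨a, b⟩ := d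
    rw [List.foldl_cons, ih, List.map_cons, List.map_cons, bitsVal_cons, bitsVal_cons]
    cases a <;> cases b <;> simp [ltStep] <;> omega

theorem ltBits_iff (a b : List Bool) : ltBits a b = true ↔ bitsVal a < bitsVal b := by
  rw [ltBits, foldl_ltStep_iff, bitsVal_map_fst_align, bitsVal_map_snd_align]
  simp

/-- The test whether two binary numbers are equal. -/
def eqBits (a b : List Bool) : Bool := !ltBits a b && !ltBits b a

theorem eqBits_iff (a b : List Bool) : eqBits a b = true ↔ bitsVal a = bitsVal b := by
  rw [eqBits, Bool.and_eq_true, Bool.not_eq_true', Bool.not_eq_true', ← Bool.not_eq_true,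
    ← Bool.not_eq_true, ltBits_iff, ltBits_iff]
  omega

section

variable {α : Type} [Enc α] {a b : α → List Bool}

@[fun_prop]
theorem polyTime_align (ha : PolyTime a) (hb : PolyTime b) :
    PolyTime fun x => align (a x) (b x) :=
  .zip (ha.append (hb.map (f := fun _ _ => false) (by fun_prop)))
    (hb.append (ha.map (f := fun _ _ => false) (by fun_prop)))

@[fun_prop]
theorem polyTime_addBits (ha : PolyTime a) (hb : PolyTime b) :
    PolyTime fun x => addBits (a x) (b x) := by
  have sum_fold : PolyTime fun x => (align (a x) (b x)).foldl addStep (false, []) :=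
    .foldl (g := fun _ => addStep) (by fun_prop) (by fun_prop) (by unfold addStep; fun_prop) 6
      fun _ ⟨_, _⟩ _ => by simp only [addStep, size_pair, size_cons, size_bool, eval_ofNat]; omega
  unfold addBits
  fun_prop

@[fun_prop]
theorem polyTime_ltBits (ha : PolyTime a) (hb : PolyTime b) :
    PolyTime fun x => ltBits (a x) (b x) :=
  .foldl (g := fun _ => ltStep) (by fun_prop) (by fun_prop)
    (.cond (by fun_prop) (by fun_prop) (by fun_prop)) 0 fun _ _ _ => by simp

@[fun_prop]
theorem polyTime_eqBits (ha : PolyTime a) (hb : PolyTime b) :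
    PolyTime fun x => eqBits (a x) (b x) := by
  unfold eqBits
  fun_prop

end

end StackLang

/-! ### Reading an election -/

namespace StackLang

open Polynomial

section

variable {α σ : Type} [Enc α] [Enc σ]

@[fun_prop]
theorem PolyTime.dropLast {l : α → List σ} (hl : PolyTime l) :
    PolyTime fun a => (l a).dropLast := by
  simpa using hl.reverse.tail.reverse

omit [Enc σ] in
theorem splitOnP_eq_foldr (p : σ → Bool) (l : List σ) :
    l.splitOnP p =
      l.foldr (fun e acc => bif p e then [] :: acc else (e :: acc.headD []) :: acc.tail) [[]] := by
  induction l with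
  | nil => exact List.splitOnP_nil
  | cons e l ih =>
    obtain ⟨w, ws, hw⟩ := List.exists_cons_of_ne_nil (List.splitOnP_ne_nil p l)
    rw [List.splitOnP_cons_eq_if_modifyHead, List.foldr_cons, ← ih, hw]
    cases p e <;> rfl

theorem PolyTime.splitOnP {l : α → List σ} {p : σ → Bool} (hl : PolyTime l) (hp : PolyTime p) :
    PolyTime fun a => (l a).splitOnP p := by
  simp only [splitOnP_eq_foldr]
  refine foldr (g := fun _ e acc => bif p e then [] :: acc else (e :: acc.headD []) :: acc.tail)
    hl (const [[]]) (cond (by fun_prop) (by fun_prop) (by fun_prop)) (X + 3) fun a e c => ?_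
  cases p e <;> cases c <;>
    simp only [cond_true, cond_false, List.headD_nil, List.headD_cons, List.tail_nil,
      List.tail_cons, size_cons, size_nil, eval_add, eval_X, eval_ofNat] <;> omega

omit [Enc σ] in
theorem splitOnP_flatMap {ι : Type} {p : σ → Bool} {f : ι → List σ} {e : σ} (he : p e = true)
    {l : List ι} (hf : ∀ i ∈ l, ∀ x ∈ f i, p x = false) :
    (l.flatMap fun i => f i ++ [e]).splitOnP p = l.map f ++ [[]] := by
  induction l with
  | nil => exact List.splitOnP_nil
  | cons i l ih =>
    rw [List.forall_mem_cons] at hf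
    rw [List.flatMap_cons, List.append_assoc, List.singleton_append,
      List.splitOnP_append_cons_of_forall_mem hf.1 e he, ih hf.2, List.map_cons, List.cons_append]

end

/-- The sections of an input, each of which is ended by an end marker `(false, false)`. -/
def sections (s : List (Bool × Bool)) : List (List (Bool × Bool)) :=
  (s.splitOnP fun e => !(e.1 || e.2)).dropLast

/-- The words of a section, each of which is ended by a comma `(false, true)`. -/
def words (s : List (Bool × Bool)) : List (List Bool) :=
  (s.splitOnP fun e => !e.1).dropLast.map (List.map Prod.snd)

/-- The symbols of a word, with a comma at the end. -/
def wordSyms (w : List Bool) : List (Bool × Bool) := w.map (true, ·) ++ [(false, true)]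

/-- The membership in the coalition and the vote of a voter, read from a section. -/
def parseVoter (s : List (Bool × Bool)) : Bool × List (List Bool) :=
  ((s.headD (false, false)).2, words s.tail)

/-- The symbols of the membership in the coalition and the vote of a voter. -/
def voterSyms (v : Bool × List (List Bool)) : List (Bool × Bool) :=
  (true, v.1) :: v.2.flatMap wordSyms

/-- An election in words, read from an input: the scores (after any further numbers in the first
section), the tie-breaking order and the voters. -/
def parse (s : List (Bool × Bool)) :
    List (List Bool) × List (List Bool) × List (Bool × List (List Bool)) :=
  (words ((sections s).headD []), words ((sections s).tail.headD []),
    (sections s).tail.tail.map parseVoter)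

/-- The input for an election in words. -/
def electionSyms (scores tie : List (List Bool)) (voters : List (Bool × List (List Bool))) :
    List (Bool × Bool) :=
  (scores.flatMap wordSyms :: tie.flatMap wordSyms :: voters.map voterSyms).flatMap
    (· ++ [(false, false)])

theorem words_flatMap (l : List (List Bool)) : words (l.flatMap wordSyms) = l := by
  unfold words wordSyms
  rw [splitOnP_flatMap (f := List.map (true, ·)) rfl (by simp), List.dropLast_concat,
    List.map_map]
  simp [Function.comp_def]

theorem or_of_mem_flatMap_wordSyms {l : List (List Bool)} {e : Bool × Bool}
    (he : e ∈ l.flatMap wordSyms) : (e.1 || e.2) = true := by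
  simp only [wordSyms, List.mem_flatMap, List.mem_append, List.mem_map, List.mem_singleton] at he
  obtain ⟨w, -, ⟨b, -, rfl⟩ | rfl⟩ := he <;> rfl

theorem sections_flatMap {l : List (List (Bool × Bool))}
    (hl : ∀ s ∈ l, ∀ e ∈ s, (e.1 || e.2) = true) :
    sections (l.flatMap (· ++ [(false, false)])) = l := by
  rw [sections, splitOnP_flatMap (f := fun s => s) rfl fun s hs e he => by rw [hl s hs e he]; rfl,
    List.dropLast_concat, List.map_id']

theorem parseVoter_voterSyms (v : Bool × List (List Bool)) : parseVoter (voterSyms v) = v := by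
  rw [parseVoter, voterSyms, List.headD_cons, List.tail_cons, words_flatMap]

theorem parse_electionSyms (scores tie : List (List Bool))
    (voters : List (Bool × List (List Bool))) :
    parse (electionSyms scores tie voters) = (scores, tie, voters) := by
  rw [parse, electionSyms, sections_flatMap]
  · simp [words_flatMap, parseVoter_voterSyms, Function.comp_def]
  · simp only [List.forall_mem_cons, List.forall_mem_map, voterSyms]
    exact ⟨fun _ => or_of_mem_flatMap_wordSyms, fun _ => or_of_mem_flatMap_wordSyms,
      fun _ _ => ⟨rfl, fun _ => or_of_mem_flatMap_wordSyms⟩⟩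

section

variable {α : Type} [Enc α] {s : α → List (Bool × Bool)}

@[fun_prop]
theorem polyTime_words (hs : PolyTime s) : PolyTime fun a => words (s a) :=
  (hs.splitOnP (by fun_prop)).dropLast.map (.map (f := fun _ => Prod.snd) (by fun_prop)
    (by fun_prop))

@[fun_prop]
theorem polyTime_sections (hs : PolyTime s) : PolyTime fun a => sections (s a) :=
  (hs.splitOnP (by fun_prop)).dropLast

theorem polyTime_parse : PolyTime parse :=
  .prodMk (by fun_prop) (.prodMk (by fun_prop) (.map (f := fun _ => parseVoter) (by fun_prop)
    (by unfold parseVoter; fun_prop)))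

end

end StackLang

/-! ### The test, carried out on words -/

namespace StackLang

open Polynomial

/-- The integer given by a word: a sign bit (`true` if it is negative) and the absolute value. -/
def signedVal (w : List Bool) : ℤ := bif w.headD false then -bitsVal w.tail else bitsVal w.tail

/-- The integer given by a pair of binary numbers, as their difference. -/
def diffVal (s : List Bool × List Bool) : ℤ := bitsVal s.1 - bitsVal s.2

/-- The addition of the integer given by a word to one given as a difference. -/
def addSigned (s : List Bool × List Bool) (w : List Bool) : List Bool × List Bool :=
  bif w.headD false then (s.1, addBits s.2 w.tail) else (addBits s.1 w.tail, s.2)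

/-- The total score of the candidate `c`, as a difference. The list `L` holds the candidates in
all positions of all votes, each with the score of its position. -/
def scoreOf (L : List (List Bool × List Bool)) (c : List Bool) : List Bool × List Bool :=
  ((L.filter fun e => eqBits e.1 c).map Prod.snd).foldl addSigned ([], [])

/-- The comparison of integers given as differences. -/
def ltDiff (r s : List Bool × List Bool) : Bool := ltBits (addBits r.1 s.2) (addBits s.1 r.2)

/-- The first candidate in the list `tie` with maximum score. -/
def winner (L : List (List Bool × List Bool)) (tie : List (List Bool)) : List Bool :=
  tie.foldl (fun b d => bif ltDiff (scoreOf L b) (scoreOf L d) then d else b) (tie.headD [])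

/-- The candidates in all positions of all votes, each with the score of its position. -/
def ballots (scores : List (List Bool)) (votes : List (List (List Bool))) :
    List (List Bool × List Bool) :=
  votes.flatMap (·.zip scores)

/-- The vote of a voter in the test: a member of the coalition ranks `x` first and `y` second. -/
def testVote (x y : List Bool) (v : Bool × List (List Bool)) : List (List Bool) :=
  bif v.1 then x :: y :: v.2.filter fun w => !eqBits w y && !eqBits w x else v.2

/-- The test whether the coalition is one of possible manipulators against `y`. -/
def againstTest (scores tie : List (List Bool)) (voters : List (Bool × List (List Bool)))
    (y : List Bool) : Bool :=
  let x := winner (ballots scores (voters.map Prod.snd)) tie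
  !eqBits y x && eqBits (winner (ballots scores (voters.map (testVote x y))) tie) y

/-- The decision procedure for CPM. The first number of an input is the common denominator. -/
def decideCPM (s : List (Bool × Bool)) : Bool :=
  (parse s).2.1.any (againstTest (parse s).1.tail (parse s).2.1 (parse s).2.2)

/-- The decision procedure for CPMW. The first two numbers of an input are the candidate and the
common denominator. -/
def decideCPMW (s : List (Bool × Bool)) : Bool :=
  againstTest (parse s).1.tail.tail (parse s).2.1 (parse s).2.2 ((parse s).1.headD [])

theorem diffVal_addSigned (s : List Bool × List Bool) (w : List Bool) :
    diffVal (addSigned s w) = diffVal s + signedVal w := by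
  unfold diffVal addSigned signedVal
  cases w.headD false <;>
    simp only [cond_true, cond_false, bitsVal_addBits, Nat.cast_add] <;> ring

theorem diffVal_foldl_addSigned (l : List (List Bool)) (s : List Bool × List Bool) :
    diffVal (l.foldl addSigned s) = diffVal s + (l.map signedVal).sum := by
  induction l generalizing s with
  | nil => simp
  | cons w l ih => rw [List.foldl_cons, ih, diffVal_addSigned, List.map_cons, List.sum_cons,
      add_assoc]

theorem diffVal_scoreOf (L : List (List Bool × List Bool)) (c : List Bool) :
    diffVal (scoreOf L c) = ((L.filter fun e => eqBits e.1 c).map fun e => signedVal e.2).sum := by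
  rw [scoreOf, diffVal_foldl_addSigned, List.map_map]
  exact zero_add _

theorem ltDiff_iff (r s : List Bool × List Bool) : ltDiff r s = true ↔ diffVal r < diffVal s := by
  rw [ltDiff, ltBits_iff, bitsVal_addBits, bitsVal_addBits, diffVal, diffVal]
  omega

theorem foldl_argAux_eq (L : List (List Bool × List Bool)) (l : List (List Bool)) (b : List Bool) :
    l.foldl (List.argAux fun b c => diffVal (scoreOf L c) < diffVal (scoreOf L b)) (some b) =
      some (l.foldl (fun b d => bif ltDiff (scoreOf L b) (scoreOf L d) then d else b) b) := by
  induction l generalizing b with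
  | nil => rfl
  | cons d l ih =>
    rw [List.foldl_cons, List.foldl_cons, ← ih]
    congr 1
    by_cases hlt : diffVal (scoreOf L b) < diffVal (scoreOf L d)
    · simp [List.argAux, hlt, (ltDiff_iff _ _).2 hlt]
    · simp [List.argAux, hlt, Bool.eq_false_iff.2 fun h => hlt ((ltDiff_iff _ _).1 h)]

theorem argmax_eq_winner (L : List (List Bool × List Bool)) {tie : List (List Bool)}
    (htie : tie ≠ []) :
    tie.argmax (fun c => diffVal (scoreOf L c)) = some (winner L tie) := by
  obtain ⟨b, l, rfl⟩ := List.exists_cons_of_ne_nil htie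
  rw [winner, List.headD_cons, ← foldl_argAux_eq, List.argmax]
  simp [List.argAux]

section

variable {α : Type} [Enc α]

@[fun_prop]
theorem polyTime_scoreOf {L : α → List (List Bool × List Bool)} {c : α → List Bool}
    (hL : PolyTime L) (hc : PolyTime c) : PolyTime fun a => scoreOf (L a) (c a) := by
  have scores : PolyTime fun a => ((L a).filter fun e => eqBits e.1 (c a)).map Prod.snd :=
    .map (f := fun _ => Prod.snd)
      (.filter (f := fun a e => eqBits e.1 (c a)) hL (by fun_prop)) (by fun_prop)
  refine .foldl (g := fun _ => addSigned) scores (by fun_prop) (by unfold addSigned; fun_prop)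
    (X + 6) fun a ⟨p, n⟩ w => ?_
  have length_p := length_addBits p w.tail
  have length_n := length_addBits n w.tail
  have length_w : w.tail.length ≤ w.length := by rw [List.length_tail]; omega
  cases hw : w.headD false <;>
    simp only [addSigned, hw, cond_true, cond_false, size_pair, size_bits, eval_add, eval_X,
      eval_ofNat] <;> omega

@[fun_prop]
theorem polyTime_ltDiff {r s : α → List Bool × List Bool} (hr : PolyTime r) (hs : PolyTime s) :
    PolyTime fun a => ltDiff (r a) (s a) := by
  unfold ltDiff
  fun_prop

@[fun_prop]
theorem polyTime_winner {L : α → List (List Bool × List Bool)} {t : α → List (List Bool)}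
    (hL : PolyTime L) (ht : PolyTime t) : PolyTime fun a => winner (L a) (t a) := by
  refine .foldl (g := fun a b d => bif ltDiff (scoreOf (L a) b) (scoreOf (L a) d) then d else b)
    ht (by fun_prop) (.cond (by fun_prop) (by fun_prop) (by fun_prop)) X fun a b d => ?_
  rw [eval_X]
  cases ltDiff (scoreOf (L a) b) (scoreOf (L a) d)
  · exact Nat.le_add_right _ _
  · exact (Nat.le_add_left _ _).trans (Nat.le_add_left _ _)

@[fun_prop]
theorem polyTime_ballots {s : α → List (List Bool)} {v : α → List (List (List Bool))}
    (hs : PolyTime s) (hv : PolyTime v) : PolyTime fun a => ballots (s a) (v a) :=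
  .flatMap hv (by fun_prop)

@[fun_prop]
theorem polyTime_testVote {x y : α → List Bool} {v : α → Bool × List (List Bool)}
    (hx : PolyTime x) (hy : PolyTime y) (hv : PolyTime v) :
    PolyTime fun a => testVote (x a) (y a) (v a) :=
  .cond (by fun_prop)
    (.cons hx (.cons hy (.filter (f := fun a w => !eqBits w (y a) && !eqBits w (x a))
      (by fun_prop) (by fun_prop)))) (by fun_prop)

@[fun_prop]
theorem polyTime_againstTest {s t : α → List (List Bool)}
    {v : α → List (Bool × List (List Bool))} {y : α → List Bool} (hs : PolyTime s)
    (ht : PolyTime t) (hv : PolyTime v) (hy : PolyTime y) :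
    PolyTime fun a => againstTest (s a) (t a) (v a) (y a) := by
  have hx : PolyTime fun a => winner (ballots (s a) ((v a).map Prod.snd)) (t a) :=
    polyTime_winner (polyTime_ballots hs (.map (f := fun _ => Prod.snd) hv (by fun_prop))) ht
  have hvotes : PolyTime fun a =>
      (v a).map (testVote (winner (ballots (s a) ((v a).map Prod.snd)) (t a)) (y a)) :=
    .map hv (polyTime_testVote (hx.comp (f := Prod.fst) (by fun_prop)) (by fun_prop)
      (by fun_prop))
  exact (polyTime_eqBits hy hx).not.and
    (polyTime_eqBits (polyTime_winner (polyTime_ballots hs hvotes) ht) hy)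

end

theorem polyTime_decideCPM : PolyTime decideCPM := by
  have hparse : PolyTime fun z : List (Bool × Bool) × List Bool => parse z.1 :=
    polyTime_parse.comp (by fun_prop)
  exact .any polyTime_parse.snd.fst (polyTime_againstTest hparse.fst.tail hparse.snd.fst
    hparse.snd.snd (by fun_prop))

theorem polyTime_decideCPMW : PolyTime decideCPMW :=
  polyTime_againstTest polyTime_parse.fst.tail.tail polyTime_parse.snd.fst polyTime_parse.snd.snd
    (polyTime_parse.fst.headD [])

end StackLang

/-! ### Correctness of the test on words -/

namespace StackLang

open Computability

theorem bitsVal_encodePosNum (p : PosNum) : bitsVal (encodePosNum p) = p := by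
  induction p with
  | one => rfl
  | bit0 p ih =>
    rw [encodePosNum, bitsVal_cons, ih, PosNum.cast_bit0, Bool.toNat_false]
    omega
  | bit1 p ih =>
    rw [encodePosNum, bitsVal_cons, ih, PosNum.cast_bit1, Bool.toNat_true]
    omega

theorem bitsVal_encodeNat (k : ℕ) : bitsVal (encodeNat k) = k := by
  conv_rhs => rw [← Num.to_of_nat k]
  rw [encodeNat]
  cases (k : Num) with
  | zero => rfl
  | pos p => exact bitsVal_encodePosNum p

/-- The word of an integer. -/
def signedWord (z : ℤ) : List Bool := decide (z < 0) :: encodeNat z.natAbs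

theorem signedVal_signedWord (z : ℤ) : signedVal (signedWord z) = z := by
  rw [signedVal, signedWord, List.headD_cons, List.tail_cons, bitsVal_encodeNat]
  by_cases hz : z < 0
  · rw [decide_eq_true hz, cond_true, Int.ofNat_natAbs_of_nonpos hz.le, neg_neg]
  · rw [decide_eq_false hz, cond_false, Int.natAbs_of_nonneg (not_lt.1 hz)]

/-- The list of the words of integer scores. -/
def scoreList {m : ℕ} (z : Fin m → ℤ) : List (List Bool) :=
  (List.finRange m).map fun i => signedWord (z i)

/-- The word of a candidate. -/
def candWord {m : ℕ} (c : Fin m) : List Bool := encodeNat c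

theorem candWord_injective {m : ℕ} : Function.Injective (candWord (m := m)) :=
  (Function.LeftInverse.injective decode_encodeNat).comp Fin.val_injective

theorem eqBits_candWord {m : ℕ} (c d : Fin m) :
    eqBits (candWord c) (candWord d) = decide (c = d) := by
  rw [Bool.eq_iff_iff, eqBits_iff, candWord, candWord, bitsVal_encodeNat, bitsVal_encodeNat,
    decide_eq_true_iff, Fin.val_inj]

/-- The list of the words of the candidates, from the most to the least preferred one. -/
def voteList {m : ℕ} (p : Preference (Fin m) m) : List (List Bool) :=
  (List.finRange m).map fun i => candWord (p.symm i)

variable {m n : ℕ}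

theorem mem_voteList (p : Preference (Fin m) m) {w : List Bool} :
    w ∈ voteList p ↔ ∃ c : Fin m, candWord c = w := by
  simp only [voteList, List.mem_map, List.mem_finRange, true_and]
  exact p.symm.exists_congr_left.trans (by simp)

theorem idxOf_voteList [BEq (List Bool)] [LawfulBEq (List Bool)] (p : Preference (Fin m) m)
    (c : Fin m) : (voteList p).idxOf (candWord c) = p c := by
  have hnodup : (voteList p).Nodup :=
    (List.nodup_finRange m).map (candWord_injective.comp p.symm.injective)
  simpa [voteList] using hnodup.idxOf_getElem (p c) (by simp [voteList])

theorem map_cycleRange_symm (k : Fin m) :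
    (List.finRange m).map k.cycleRange.symm = k :: (List.finRange m).filter (· ≠ k) := by
  obtain _ | m := m
  · exact k.elim0
  rw [List.finRange_succ, List.map_cons, Fin.cycleRange_symm_zero, List.map_map,
    ← List.finRange_succ]
  congr 1
  have map_succAbove : k.cycleRange.symm ∘ Fin.succ = k.succAbove :=
    funext (Fin.cycleRange_symm_succ k)
  rw [map_succAbove]
  refine List.SortedLT.eq_of_mem_iff
    ((Fin.strictMono_succAbove k).sortedLT_listMap.2 (List.sortedLT_finRange m))
    ((List.sortedLT_finRange _).pairwise.filter _).sortedLT fun a => ?_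
  simp [Fin.exists_succAbove_eq_iff]

theorem voteList_moveToTop (p : Preference (Fin m) m) (c : Fin m) :
    voteList (p.moveToTop c) =
      candWord c :: (voteList p).filter fun w => !eqBits w (candWord c) := by
  calc voteList (p.moveToTop c)
    _ = ((List.finRange m).map (p c).cycleRange.symm).map fun i => candWord (p.symm i) := by
      rw [List.map_map]; rfl
    _ = candWord c :: ((List.finRange m).filter (· ≠ p c)).map fun i => candWord (p.symm i) := by
      rw [map_cycleRange_symm, List.map_cons, Equiv.symm_apply_apply]
    _ = candWord c :: (voteList p).filter fun w => !eqBits w (candWord c) := by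
      rw [voteList, List.filter_map]
      congr 2
      refine List.filter_congr fun i _ => ?_
      simp [eqBits_candWord, Equiv.symm_apply_eq]

open Classical in
theorem testVote_voteList (P : Profile (Fin n) (Fin m) m) (M : Finset (Fin n)) {x y : Fin m}
    (hyx : y ≠ x) (v : Fin n) :
    testVote (candWord x) (candWord y) (decide (v ∈ M), voteList (P v)) =
      voteList (replaceVotes P M (testVotes P M x y) v) := by
  by_cases hv : v ∈ M
  · rw [testVote, decide_eq_true hv, cond_true, replaceVotes_of_mem hv, testVotes,
      voteList_moveToTop, voteList_moveToTop,
      List.filter_cons_of_pos (by simpa [eqBits_candWord] using hyx), List.filter_filter]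
    simp only [Bool.and_comm]
  · rw [testVote, decide_eq_false hv, cond_false, replaceVotes_of_notMem hv]

theorem filter_zip_voteList (p : Preference (Fin m) m) (z : Fin m → ℤ) (c : Fin m) :
    ((voteList p).zip (scoreList z)).filter (fun e => eqBits e.1 (candWord c)) =
      [(candWord c, signedWord (z (p c)))] := by
  have hfilter : (List.finRange m).filter (fun i => eqBits (candWord (p.symm i)) (candWord c)) =
      [p c] := by
    simp only [eqBits_candWord, Equiv.symm_apply_eq]
    rw [List.filter_eq, List.count_finRange, List.replicate_one]
  rw [voteList, scoreList, List.zip_map', List.filter_map, Function.comp_def, hfilter]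
  simp

theorem diffVal_scoreOf_ballots (z : Fin m → ℤ) (P : Profile (Fin n) (Fin m) m) (c : Fin m) :
    diffVal (scoreOf (ballots (scoreList z) ((List.finRange n).map fun v => voteList (P v)))
      (candWord c)) = ∑ v, z (P v c) := by
  rw [diffVal_scoreOf, ballots, List.flatMap_map, List.filter_flatMap, List.map_flatMap,
    Fin.sum_univ_def]
  simp only [filter_zip_voteList, List.map_singleton, signedVal_signedWord]
  rw [← List.map_eq_flatMap]

section

variable {α : Fin m → ℝ} {t : Preference (Fin m) m} {z : Fin m → ℤ} {D : ℝ}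

theorem totalScore_le_totalScore_iff_of_mul (hD : 0 < D) (hz : ∀ i, (z i : ℝ) = α i * D)
    (P : Profile (Fin n) (Fin m) m) (c d : Fin m) :
    totalScore α P c ≤ totalScore α P d ↔ ∑ v, z (P v c) ≤ ∑ v, z (P v d) := by
  have sum_eq (c : Fin m) : ((∑ v, z (P v c) : ℤ) : ℝ) = totalScore α P c * D := by
    simp only [Int.cast_sum, hz, totalScore, Finset.sum_mul]
  rw [← Int.cast_le (R := ℝ), sum_eq, sum_eq, mul_le_mul_iff_left₀ hD]

theorem winner_ballots [Nonempty (Fin m)] (t : Preference (Fin m) m) (hD : 0 < D)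
    (hz : ∀ i, (z i : ℝ) = α i * D) (P : Profile (Fin n) (Fin m) m) :
    winner (ballots (scoreList z) ((List.finRange n).map fun v => voteList (P v))) (voteList t) =
      candWord (scoringRule α t P) := by
  have hle := totalScore_le_totalScore_iff_of_mul hD hz P
  have hrule (d : Fin m) :=
    standing_le_iff.1 (scoringRule_eq_iff.1 (rfl : scoringRule α t P = _) d)
  have htie : voteList t ≠ [] :=
    List.ne_nil_of_mem ((mem_voteList t).2 ⟨scoringRule α t P, rfl⟩)
  refine Option.some_injective _ ((argmax_eq_winner _ htie).symm.trans ?_)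
  rw [List.argmax_eq_some_iff]
  simp only [mem_voteList, forall_exists_index, forall_apply_eq_imp_iff, diffVal_scoreOf_ballots,
    ← hle, idxOf_voteList]
  refine ⟨⟨_, rfl⟩, fun d => ?_, fun d hd => ?_⟩
  · exact (hrule d).elim le_of_lt fun h => h.1.le
  · exact (hrule d).elim (fun hlt => absurd hd hlt.not_ge) And.right

open Classical in
theorem againstTest_iff [Nonempty (Fin m)] (hα : Antitone α) (hgap : FirstGapMinimal α) (hD : 0 < D)
    (hz : ∀ i, (z i : ℝ) = α i * D) (P : Profile (Fin n) (Fin m) m) (M : Finset (Fin n))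
    (y : Fin m) :
    againstTest (scoreList z) (voteList t)
      ((List.finRange n).map fun v => (decide (v ∈ M), voteList (P v))) (candWord y) = true ↔
      IsCoalitionAgainst (scoringRule α t) P M y := by
  have hwin := winner_ballots (n := n) t hD hz
  by_cases hyx : y = scoringRule α t P
  · refine iff_of_false ?_ fun h => h.1 hyx
    simp [againstTest, List.map_map, Function.comp_def, hwin, ← hyx, eqBits_candWord]
  · rw [isCoalitionAgainst_iff hα hgap rfl hyx]
    simp [againstTest, List.map_map, Function.comp_def, hwin, testVote_voteList P M hyx,
      eqBits_candWord, hyx]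

end

end StackLang

/-! ### Correctness of the decision procedures -/

namespace StackLang

open Computability

variable {m : ℕ}

theorem map_symPair_nat (k : ℕ) : (Encode.nat k).map symPair = wordSyms (encodeNat k) := by
  simp [Encode.nat, wordSyms, symPair, Function.comp_def]

theorem map_symPair_int (z : ℤ) : (Encode.int z).map symPair = wordSyms (signedWord z) := by
  rw [Encode.int, List.map_cons, map_symPair_nat]
  rfl

theorem map_symPair_preference (p : Preference (Fin m) m) :
    (Encode.preference p).map symPair = (voteList p).flatMap wordSyms ++ [(false, false)] := by
  simp [Encode.preference, List.map_flatMap, map_symPair_nat, voteList, candWord,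
    List.flatMap_map, symPair]

/-- The numerators of a rational vector over its least common denominator. -/
def numerators (q : Fin m → ℚ) (i : Fin m) : ℤ := (q i * Encode.commonDen q).num

theorem map_symPair_ratVector (q : Fin m → ℚ) :
    (Encode.ratVector q).map symPair =
      (encodeNat (Encode.commonDen q) :: scoreList (numerators q)).flatMap wordSyms ++
        [(false, false)] := by
  simp [Encode.ratVector, List.map_flatMap, map_symPair_nat, map_symPair_int, List.flatMap_map,
    symPair, scoreList, numerators]

theorem commonDen_pos (q : Fin m → ℚ) : 0 < Encode.commonDen q :=
  Nat.pos_of_ne_zero fun h =>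
    let ⟨i, _, hi⟩ := Finset.lcm_eq_zero_iff.1 h
    (q i).den_ne_zero hi

theorem intCast_numerators (q : Fin m → ℚ) (i : Fin m) :
    (numerators q i : ℚ) = q i * Encode.commonDen q := by
  obtain ⟨k, hk⟩ : (q i).den ∣ Encode.commonDen q := Finset.dvd_lcm (Finset.mem_univ i)
  have integral : q i * Encode.commonDen q = ((q i).num * k : ℤ) := by
    rw [hk]
    push_cast
    rw [← mul_assoc, Rat.mul_den_eq_num]
  rw [numerators, integral, Rat.num_intCast]

open Classical in
/-- The list of the voters, each with the membership in the coalition and the vote. -/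
noncomputable def voterList (I : CPMInput) : List (Bool × List (List Bool)) :=
  (List.finRange I.n).map fun v => (decide (v ∈ I.M), voteList (I.profile v))

theorem map_symPair_cpm (I : CPMInput) :
    (Encode.cpm I).map symPair =
      electionSyms (encodeNat (Encode.commonDen I.scores) :: scoreList (numerators I.scores))
        (voteList I.tie) (voterList I) := by
  rw [Encode.cpm, List.map_append, List.map_append, map_symPair_ratVector, map_symPair_preference,
    List.map_flatMap]
  simp only [electionSyms, voterList, List.map_map, List.flatMap_map, List.flatMap_cons,
    List.append_assoc]
  simp [map_symPair_preference, voterSyms, symPair]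

theorem map_symPair_cpmw (I : CPMWInput) :
    (Encode.cpmw I).map symPair =
      electionSyms
        (candWord I.y :: encodeNat (Encode.commonDen I.scores) :: scoreList (numerators I.scores))
        (voteList I.tie) (voterList I.toCPMInput) := by
  rw [Encode.cpmw, List.map_append, map_symPair_nat, map_symPair_cpm]
  simp only [electionSyms, candWord, List.flatMap_cons, List.append_assoc]

theorem againstTest_voterList_iff (I : CPMInput) (hI : FirstGapMinimal I.vector) (y : Fin I.m) :
    againstTest (scoreList (numerators I.scores)) (voteList I.tie) (voterList I) (candWord y) =
      true ↔ IsCoalitionAgainst I.rule I.profile I.M y :=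
  haveI : Nonempty (Fin I.m) := ⟨y⟩
  againstTest_iff I.isScoringVector.antitone hI (Nat.cast_pos.2 (commonDen_pos I.scores))
    (fun i => by exact_mod_cast congrArg (Rat.cast (K := ℝ)) (intCast_numerators I.scores i))
    I.profile I.M y

theorem decideCPM_iff (I : CPMInput) (hI : FirstGapMinimal I.vector) :
    decideCPM ((Encode.cpm I).map symPair) = true ↔ CPM I := by
  rw [decideCPM, map_symPair_cpm, parse_electionSyms]
  simp only [List.any_eq_true, List.tail_cons, mem_voteList, exists_exists_eq_and,
    againstTest_voterList_iff I hI]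
  rfl

theorem decideCPMW_iff (I : CPMWInput) (hI : FirstGapMinimal I.vector) :
    decideCPMW ((Encode.cpmw I).map symPair) = true ↔ CPMW I := by
  rw [decideCPMW, map_symPair_cpmw, parse_electionSyms]
  exact againstTest_voterList_iff I.toCPMInput hI I.y

end StackLang

theorem mainTheorem2 :
    -- correctness of the test, for all real scoring vectors of the class
    (∀ (V C : Type*) [Fintype V] [Fintype C] [Nonempty C] (m : ℕ) (α : Fin m → ℝ)
        (t : Preference C m), IsScoringVector α → FirstGapMinimal α →
        ∀ (P : Profile V C m) (M : Finset V) (x y : C), scoringRule α t P = x → y ≠ x →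
          (IsCoalitionAgainst (scoringRule α t) P M y ↔
            scoringRule α t (replaceVotes P M (testVotes P M x y)) = y)) ∧
    -- CPMW and CPM are in P for the class
    InP (fun I : {I : CPMWInput // FirstGapMinimal I.vector} => Encode.cpmw I.1)
      (fun I => CPMW I.1) ∧
    InP (fun I : {I : CPMInput // FirstGapMinimal I.vector} => Encode.cpm I.1)
      (fun I => CPM I.1) ∧
    -- the class contains the Borda rule
    (∀ m : ℕ, 2 ≤ m → IsScoringVector (bordaVector m) ∧ FirstGapMinimal (bordaVector m)) := by
  refine ⟨fun V C _ _ _ m α t hα hgap P M x y hx hyx =>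
      isCoalitionAgainst_iff hα.antitone hgap hx hyx,
    StackLang.inP_of_polyTime StackLang.polyTime_decideCPMW fun I =>
      StackLang.decideCPMW_iff I.1 I.2,
    StackLang.inP_of_polyTime StackLang.polyTime_decideCPM fun I =>
      StackLang.decideCPM_iff I.1 I.2,
    fun m hm => ⟨isScoringVector_bordaVector hm, firstGapMinimal_bordaVector m⟩⟩
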